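/- There are absolute constants $C, c > 0$ such that the following holds. Let $n, p$ be positive integers and $\theta \in (0,1]$ with $\theta > 1/\sqrt{n}$ and $p \ge Cn$. Let $\mathbf x_0 \in \mathbb R^p$ have i.i.d. entries equal to $1/\sqrt{\theta p}$ with probability $\theta$ and to $0$ with probability $1-\theta$, let $\mathbf G = [\mathbf g_1 \mid \dots \mid \mathbf g_{n-1}] \in \mathbb R^{p\times(n-1)}$ have i.i.d. $\mathcal N(0, 1/p)$ entries, with $\mathbf x_0$ and $\mathbf G$ independent, and let $\mathcal S = \mathrm{span}(\mathbf x_0, \mathbf g_1, \dots, \mathbf g_{n-1})$. Let $$\mathbf Y = \Big[\, \tfrac{\mathbf x_0}{\|\mathbf x_0\|_2} \;\Big|\; \mathcal P_{\mathbf x_0^\perp}\mathbf G\,\big(\mathbf G^\top \mathcal P_{\mathbf x_0^\perp}\mathbf G\big)^{-1/2} \Big] \in \mathbb R^{p\times n},$$ where $\mathcal P_{\mathbf x_0^\perp}$ is the orthogonal projection onto the orthogonal complement of $\mathbf x_0$, and let $\mathbf y^1, \dots, \mathbf y^p \in \mathbb R^n$ be the rows of $\mathbf Y$. With probability at least $1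 - c\,p^{-2}$, the columns of $\mathbf Y$ are well defined and form an orthonormal basis of $\mathcal S$, and there is an index $i \in \{1,\dots,p\}$ such that $$\left|\left\langle \frac{\mathbf y^i}{\|\mathbf y^i\|_2}, \mathbf e_1 \right\rangle\right| \ge \frac{1}{10\sqrt{\theta n}},$$ and such that moreover, for every matrix $\widehat{\mathbf Y} \in \mathbb R^{p \times n}$ whose columns form an orthonormal basis of $\mathcal S$, with rows $\widehat{\mathbf y}^1, \dots, \widehat{\mathbf y}^p$, and every target direction $\mathbf q_\star$ for it (a unit vector $\mathbf q_\star\in\mathbb R^n$ with $\mathbf x_0 = \gamma\,\widehat{\mathbf Y}\mathbf q_\star$ for some $\gamma \ne 0$), $$\left|\left\langle \frac{\widehat{\mathbf y}^i}{\|\widehat{\mathbf y}^i\|_2}, \mathbf q_\star \right\rangle\right| \ge \frac{1}{10\sqrt{\theta n}}.$$ -/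

import Mathlib

open MeasureTheory ProbabilityTheory
open scoped Matrix

noncomputable section

namespace PlantedSparse

/-- The Euclidean norm of a coordinate vector (the norm on `Fin k → ℝ` itself is the sup norm). -/
def l2norm {k : ℕ} (v : Fin k → ℝ) : ℝ := ‖WithLp.toLp 2 v‖

/-- The planted sparse model: `x₀` has i.i.d. entries that equal `1 / √(θ p)` with probability `θ`
and `0` otherwise, `G = [g₁ | … | g_m]` has i.i.d. entries `N(0, 1/p)`, and all these entries are
jointly independent. -/
structure IsPlantedSparseModel {Ω : Type*} [MeasurableSpace Ω] (P : Measure Ω)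
    (θ : unitInterval) {p m : ℕ} (x₀ : Ω → Fin p → ℝ) (G : Ω → Matrix (Fin p) (Fin m) ℝ) :
    Prop where
  law_sparse : ∀ i, HasLaw (fun ω => x₀ ω i) (bernoulliMeasure (1 / √((θ : ℝ) * p)) 0 θ) P
  law_gauss : ∀ i j, HasLaw (fun ω => G ω i j) (gaussianReal 0 (1 / (p : NNReal))) P
  indep : iIndepFun
    (fun (k : Fin p ⊕ Fin p × Fin m) (ω : Ω) =>
      Sum.elim (fun i => x₀ ω i) (fun ij => G ω ij.1 ij.2) k) P

/-- The subspace `S = span(x₀, g₁, …, g_m)` of `ℝᵖ`, where `g₁, …, g_m` are the columns of `G`. -/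
def plantedSubspace {p m : ℕ} (x : Fin p → ℝ) (G : Matrix (Fin p) (Fin m) ℝ) :
    Submodule ℝ (Fin p → ℝ) :=
  Submodule.span ℝ (insert x (Set.range G.col))

/-- The columns of `Y` are an orthonormal basis of the subspace `S`. -/
def IsOrthonormalBasisOf {p n : ℕ} (Y : Matrix (Fin p) (Fin n) ℝ)
    (S : Submodule ℝ (Fin p → ℝ)) : Prop :=
  Yᵀ * Y = 1 ∧ Submodule.span ℝ (Set.range Y.col) = S

/-- The matrix of the orthogonal projection of `ℝᵖ` onto the orthogonal complement of `x`. -/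
def projPerp {p : ℕ} (x : Fin p → ℝ) : Matrix (Fin p) (Fin p) ℝ :=
  1 - (l2norm x ^ 2)⁻¹ • Matrix.vecMulVec x x

section
open scoped MatrixOrder

/-- `A ^ (-1/2)` for a positive definite matrix `A`: the inverse of its positive semidefinite
square root. -/
def invSqrt {m : ℕ} (A : Matrix (Fin m) (Fin m) ℝ) : Matrix (Fin m) (Fin m) ℝ :=
  (CFC.sqrt A)⁻¹

end

/-- `G' = P G (Gᵀ P G) ^ (-1/2)`, with `P` the projection onto the orthogonal complement of `x`. -/
def orthGauss {p m : ℕ} (x : Fin p → ℝ) (G : Matrix (Fin p) (Fin m) ℝ) :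
    Matrix (Fin p) (Fin m) ℝ :=
  projPerp x * G * invSqrt (Gᵀ * projPerp x * G)

/-- The canonical basis `Y = [x / ‖x‖₂ | G']`. -/
def canonicalBasis {p m : ℕ} (x : Fin p → ℝ) (G : Matrix (Fin p) (Fin m) ℝ) :
    Matrix (Fin p) (Fin (m + 1)) ℝ :=
  Matrix.of fun i => Fin.cons (x i / l2norm x) (orthGauss x G i)

/-- The `i`-th initialization vector `yⁱ / ‖yⁱ‖₂`, where `yⁱ` is the `i`-th row of `Y`. -/
def initVec {p n : ℕ} (Y : Matrix (Fin p) (Fin n) ℝ) (i : Fin p) : Fin n → ℝ :=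
  (l2norm (Y.row i))⁻¹ • Y.row i

/-- `q` is a target direction for the basis `Y`: a unit vector such that `x = γ Y q` for some
`γ ≠ 0`. -/
def IsTarget {p n : ℕ} (Y : Matrix (Fin p) (Fin n) ℝ) (x : Fin p → ℝ) (q : Fin n → ℝ) : Prop :=
  l2norm q = 1 ∧ ∃ γ : ℝ, γ ≠ 0 ∧ x = γ • (Y *ᵥ q)

end PlantedSparse

end

namespace PlantedSparse

/-! The correlation does not depend on the basis. Two orthonormal bases of the subspace share the
projection `Y * Yᵀ`, whose diagonal holds the squared row norms, and a target direction pairs with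
row `i` to `x i / γ` with `|γ| = ‖x‖`. It therefore suffices to study the canonical basis
(`abs_initVec_dotProduct_target`).

Almost surely `x` is a constant `v` on its support `I` and zero elsewhere. With `K = |I|`, the
squared correlation at `i ∈ I` is `1 / (1 + K s)`, where `s` is the squared norm of row `i` of
`orthGauss`. If `Gᵀ P G ≥ lam` and the rows of `G` in `I` have total squared norm at most `F`, the
corresponding rows of `orthGauss` have total at most `F / lam`. Some `i ∈ I` is no worse than
average, so its correlation is at least `(1 + F / lam)^(-1/2)` (`orthonormal_and_correlation`).

The random input is `lam = 1/15`, `F = 6 θ m` and `0 < K < 2 θ p`. A net argument gives `‖G a‖² ≥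
‖a‖² / 9`, and a chi-square tail shows that the direction of `x` removes at most `2/45`. The row sum
is a chi-square variable once the support is fixed, and independence of `x₀` and `G` allows this
fixing (`measure_exists_supp_le`). Chernoff bounds control `K`. Each failure probability is `O(exp
(-√p / 100))`, hence `O(p⁻²)`. -/

lemma l2norm_sq {k : ℕ} (v : Fin k → ℝ) : l2norm v ^ 2 = v ⬝ᵥ v := by
  rw [l2norm, EuclideanSpace.norm_sq_eq]
  simp [dotProduct, sq]

lemma l2norm_eq_sqrt {k : ℕ} (v : Fin k → ℝ) : l2norm v = √(v ⬝ᵥ v) := by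
  rw [← l2norm_sq, Real.sqrt_sq (by exact norm_nonneg _)]

lemma l2norm_pos {k : ℕ} {v : Fin k → ℝ} (hv : v ≠ 0) : 0 < l2norm v := by
  rw [l2norm, norm_pos_iff]
  simpa using hv

lemma dotProduct_self_pos {k : ℕ} {v : Fin k → ℝ} (hv : v ≠ 0) : 0 < v ⬝ᵥ v := by
  rw [← l2norm_sq]
  exact pow_pos (l2norm_pos hv) 2

/-! ### Projection onto the orthogonal complement of `x`. -/

section projPerp
variable {p : ℕ} (x : Fin p → ℝ)

lemma projPerp_mulVec (v : Fin p → ℝ) :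
    projPerp x *ᵥ v = v - ((x ⬝ᵥ x)⁻¹ * (x ⬝ᵥ v)) • x := by
  rw [projPerp, l2norm_sq, Matrix.sub_mulVec, Matrix.one_mulVec, Matrix.smul_mulVec,
    Matrix.vecMulVec_mulVec]
  ext i
  simp
  ring

lemma projPerp_transpose : (projPerp x)ᵀ = projPerp x := by
  rw [projPerp, Matrix.transpose_sub, Matrix.transpose_one, Matrix.transpose_smul,
    Matrix.transpose_vecMulVec]

variable {x}

lemma projPerp_mulVec_self (hx : x ≠ 0) : projPerp x *ᵥ x = 0 := by
  rw [projPerp_mulVec, inv_mul_cancel₀ (dotProduct_self_pos hx).ne', one_smul, sub_self]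

lemma projPerp_mul_self (hx : x ≠ 0) : projPerp x * projPerp x = projPerp x := by
  refine Matrix.ext_iff_mulVec.2 fun v => ?_
  rw [← Matrix.mulVec_mulVec, projPerp_mulVec x v, Matrix.mulVec_sub, Matrix.mulVec_smul,
    projPerp_mulVec_self hx, projPerp_mulVec]
  simp

lemma vecMul_projPerp (hx : x ≠ 0) : x ᵥ* projPerp x = 0 := by
  rw [← Matrix.mulVec_transpose, projPerp_transpose, projPerp_mulVec_self hx]

/-- Reduces positivity of the Gram matrix to a lower bound on `‖G a‖²` and an upper bound on the
component of `G a` along `x`. -/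
lemma gram_quadratic {m : ℕ} (x : Fin p → ℝ) (G : Matrix (Fin p) (Fin m) ℝ) (a : Fin m → ℝ) :
    a ⬝ᵥ ((Gᵀ * projPerp x * G) *ᵥ a) =
      (G *ᵥ a) ⬝ᵥ (G *ᵥ a) - (x ⬝ᵥ x)⁻¹ * (x ⬝ᵥ (G *ᵥ a)) ^ 2 := by
  rw [← Matrix.mulVec_mulVec, ← Matrix.mulVec_mulVec, Matrix.dotProduct_mulVec,
    Matrix.vecMul_transpose, projPerp_mulVec, dotProduct_sub, dotProduct_smul,
    dotProduct_comm (G *ᵥ a) x]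
  simp
  ring

end projPerp

/-! ### The inverse square root of a positive definite matrix. -/

section invSqrt
open scoped MatrixOrder
variable {m : ℕ} {A : Matrix (Fin m) (Fin m) ℝ}

lemma invSqrt_transpose : (invSqrt A)ᵀ = invSqrt A := by
  have h : (CFC.sqrt A).IsHermitian := (Matrix.nonneg_iff_posSemidef.1 (CFC.sqrt_nonneg A)).isHermitian
  rw [invSqrt, Matrix.transpose_nonsing_inv]
  rw [Matrix.IsHermitian, Matrix.conjTranspose_eq_transpose_of_trivial] at h
  rw [h]

lemma isUnit_sqrt (hA : A.PosDef) : IsUnit (CFC.sqrt A) :=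
  (CFC.isUnit_sqrt_iff A hA.posSemidef.nonneg).2 hA.isUnit

lemma invSqrt_mul_mul_invSqrt (hA : A.PosDef) : invSqrt A * A * invSqrt A = 1 := by
  have h := (Matrix.isUnit_iff_isUnit_det _).1 (isUnit_sqrt hA)
  have h2 : CFC.sqrt A * CFC.sqrt A = A := CFC.sqrt_mul_sqrt_self A hA.posSemidef.nonneg
  calc invSqrt A * A * invSqrt A
      = ((CFC.sqrt A)⁻¹ * CFC.sqrt A) * (CFC.sqrt A * (CFC.sqrt A)⁻¹) := by
        rw [invSqrt]; nth_rewrite 2 [← h2]; simp only [Matrix.mul_assoc]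
    _ = 1 := by rw [Matrix.nonsing_inv_mul _ h, Matrix.mul_nonsing_inv _ h, one_mul]

/-- Lets `P G` be recovered from `orthGauss`, so that passing to `orthGauss` does not shrink the
column span. -/
lemma exists_invSqrt_mul_eq_one (hA : A.PosDef) : ∃ B, invSqrt A * B = 1 :=
  ⟨CFC.sqrt A, Matrix.nonsing_inv_mul _ ((Matrix.isUnit_iff_isUnit_det _).1 (isUnit_sqrt hA))⟩

end invSqrt

/-! ### The canonical basis is an orthonormal basis of the planted subspace. -/

section canonicalBasis
variable {p m : ℕ} {x : Fin p → ℝ} {G : Matrix (Fin p) (Fin m) ℝ}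

lemma orthGauss_transpose_mul_self (hx : x ≠ 0) (hA : (Gᵀ * projPerp x * G).PosDef) :
    (orthGauss x G)ᵀ * orthGauss x G = 1 := by
  rw [orthGauss, Matrix.transpose_mul, Matrix.transpose_mul, invSqrt_transpose,
    projPerp_transpose]
  calc _ = invSqrt (Gᵀ * projPerp x * G) * (Gᵀ * (projPerp x * projPerp x) * G) *
        invSqrt (Gᵀ * projPerp x * G) := by simp only [Matrix.mul_assoc]
    _ = 1 := by rw [projPerp_mul_self hx, invSqrt_mul_mul_invSqrt hA]

lemma vecMul_orthGauss (hx : x ≠ 0) : x ᵥ* orthGauss x G = 0 := by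
  rw [orthGauss, ← Matrix.vecMul_vecMul, ← Matrix.vecMul_vecMul, vecMul_projPerp hx]
  simp

lemma canonicalBasis_col_zero : (canonicalBasis x G).col 0 = (l2norm x)⁻¹ • x := by
  ext i
  simp [canonicalBasis, Matrix.col, div_eq_inv_mul]

lemma canonicalBasis_col_succ (j : Fin m) :
    (canonicalBasis x G).col j.succ = (orthGauss x G).col j := by
  ext i
  simp [canonicalBasis, Matrix.col]

lemma canonicalBasis_orthonormal (hx : x ≠ 0) (hA : (Gᵀ * projPerp x * G).PosDef) :
    (canonicalBasis x G)ᵀ * canonicalBasis x G = 1 := by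
  have hn := l2norm_pos hx
  have h1 := orthGauss_transpose_mul_self hx hA
  have h2 := vecMul_orthGauss (G := G) hx
  have h0 (j : Fin m) : x ⬝ᵥ (orthGauss x G).col j = 0 := congrFun h2 j
  have key (k l) : ((canonicalBasis x G)ᵀ * canonicalBasis x G) k l =
    (canonicalBasis x G).col k ⬝ᵥ (canonicalBasis x G).col l := rfl
  ext k l
  rw [key]
  refine Fin.cases ?_ (fun k => ?_) k <;> refine Fin.cases ?_ (fun l => ?_) l
  · rw [canonicalBasis_col_zero, smul_dotProduct, dotProduct_smul, ← l2norm_sq]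
    simp
    field_simp
  · rw [canonicalBasis_col_zero, canonicalBasis_col_succ, smul_dotProduct, h0]
    simp [(Fin.succ_ne_zero l).symm]
  · rw [canonicalBasis_col_zero, canonicalBasis_col_succ, dotProduct_smul, dotProduct_comm, h0]
    simp
  · rw [canonicalBasis_col_succ, canonicalBasis_col_succ]
    refine (congrFun (congrFun h1 k) l).trans ?_
    simp [Matrix.one_apply]

lemma col_mul_mem_span {k l : ℕ} (M : Matrix (Fin p) (Fin k) ℝ) (B : Matrix (Fin k) (Fin l) ℝ)
    (j : Fin l) : (M * B).col j ∈ Submodule.span ℝ (Set.range M.col) := by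
  have : (M * B).col j = ∑ i, B i j • M.col i := by
    ext r
    simp [Matrix.mul_apply, Matrix.col, mul_comm]
  rw [this]
  exact Submodule.sum_mem _ fun i _ => Submodule.smul_mem _ _ (Submodule.subset_span ⟨i, rfl⟩)

lemma col_projPerp_mul (j : Fin m) :
    (projPerp x * G).col j = G.col j - ((x ⬝ᵥ x)⁻¹ * (x ⬝ᵥ G.col j)) • x := by
  rw [← projPerp_mulVec]
  rfl

lemma canonicalBasis_span (hx : x ≠ 0) (hA : (Gᵀ * projPerp x * G).PosDef) :
    Submodule.span ℝ (Set.range (canonicalBasis x G).col) = plantedSubspace x G := by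
  have hn := l2norm_pos hx
  have hxS : x ∈ plantedSubspace x G := Submodule.subset_span (Set.mem_insert _ _)
  have hxY : x ∈ Submodule.span ℝ (Set.range (canonicalBasis x G).col) := by
    have h : x = l2norm x • (canonicalBasis x G).col 0 := by
      rw [canonicalBasis_col_zero, smul_smul, mul_inv_cancel₀ hn.ne', one_smul]
    rw [h]
    exact Submodule.smul_mem _ _ (Submodule.subset_span ⟨0, by rw [← h]⟩)
  obtain ⟨B, hB⟩ := exists_invSqrt_mul_eq_one hA
  have hP : projPerp x * G = orthGauss x G * B := by
    rw [orthGauss, Matrix.mul_assoc _ (invSqrt _), hB, Matrix.mul_one]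
  apply le_antisymm
  · rw [Submodule.span_le]
    rintro _ ⟨k, rfl⟩
    refine Fin.cases ?_ (fun j => ?_) k
    · rw [canonicalBasis_col_zero]
      exact Submodule.smul_mem _ _ hxS
    · rw [canonicalBasis_col_succ]
      have : Submodule.span ℝ (Set.range (projPerp x * G).col) ≤ plantedSubspace x G := by
        rw [Submodule.span_le]
        rintro _ ⟨j, rfl⟩
        rw [col_projPerp_mul]
        exact Submodule.sub_mem _ (Submodule.subset_span (Set.mem_insert_of_mem _ ⟨j, rfl⟩))
          (Submodule.smul_mem _ _ hxS)
      exact this (col_mul_mem_span _ _ j)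
  · rw [plantedSubspace, Submodule.span_le]
    rintro _ (rfl | ⟨j, rfl⟩)
    · exact hxY
    · have h1 : G.col j = (projPerp x * G).col j + ((x ⬝ᵥ x)⁻¹ * (x ⬝ᵥ G.col j)) • x := by
        rw [col_projPerp_mul, sub_add_cancel]
      rw [h1]
      refine Submodule.add_mem _ ?_ (Submodule.smul_mem _ _ hxY)
      rw [hP]
      refine Submodule.span_mono ?_ (col_mul_mem_span _ _ j)
      rintro _ ⟨k, rfl⟩
      exact ⟨k.succ, canonicalBasis_col_succ k⟩

end canonicalBasis

/-- Two orthonormal bases of the same subspace have the same projection matrix. -/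
lemma IsOrthonormalBasisOf.mul_transpose_eq {p n k : ℕ} {Y : Matrix (Fin p) (Fin n) ℝ}
    {Z : Matrix (Fin p) (Fin k) ℝ} {S : Submodule ℝ (Fin p → ℝ)}
    (hY : IsOrthonormalBasisOf Y S) (hZ : IsOrthonormalBasisOf Z S) : Y * Yᵀ = Z * Zᵀ := by
  have key {a b : ℕ} {U : Matrix (Fin p) (Fin a) ℝ} {V : Matrix (Fin p) (Fin b) ℝ}
      (hU : IsOrthonormalBasisOf U S) (hV : IsOrthonormalBasisOf V S) :
      U * Uᵀ * (V * Vᵀ) = V * Vᵀ := by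
    -- `U * Uᵀ` fixes `S` pointwise, and the columns of `V` lie in `S`.
    suffices h : U * Uᵀ * V = V by rw [← Matrix.mul_assoc, h]
    have hfix : ∀ v ∈ S, (U * Uᵀ) *ᵥ v = v := by
      intro v hv
      rw [← hU.2, ← Matrix.range_mulVecLin] at hv
      obtain ⟨w, rfl⟩ := hv
      rw [Matrix.mulVecLin_apply, Matrix.mulVec_mulVec, Matrix.mul_assoc, hU.1, Matrix.mul_one]
    ext i j
    have hj : V.col j ∈ S := by
      rw [← hV.2]
      exact Submodule.subset_span ⟨j, rfl⟩
    exact congrFun (hfix _ hj) i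
  have h1 := key hY hZ
  -- Both projections are symmetric, so transposing the reversed absorption identity turns the same
  -- product into the other projection.
  have h2 := congrArg Matrix.transpose (key hZ hY)
  simp only [Matrix.transpose_mul, Matrix.transpose_transpose] at h2
  rw [← h1, h2]

/-- The correlation of the `i`-th initialization vector with a target direction does not depend on
the orthonormal basis. -/
lemma abs_initVec_dotProduct_target {p m : ℕ} {x : Fin p → ℝ} (hx : x ≠ 0)
    {G : Matrix (Fin p) (Fin m) ℝ} {S : Submodule ℝ (Fin p → ℝ)}
    (hB : IsOrthonormalBasisOf (canonicalBasis x G) S)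
    {Y : Matrix (Fin p) (Fin (m + 1)) ℝ} {q : Fin (m + 1) → ℝ}
    (hY : IsOrthonormalBasisOf Y S) (hq : IsTarget Y x q) (i : Fin p) :
    |initVec Y i ⬝ᵥ q| = (√(x i ^ 2 / (x ⬝ᵥ x) + ∑ j, orthGauss x G i j ^ 2))⁻¹ *
      (|x i| / √(x ⬝ᵥ x)) := by
  obtain ⟨hq1, γ, hγ, hxq⟩ := hq
  have hn := l2norm_pos hx
  have hdiag : Y.row i ⬝ᵥ Y.row i = x i ^ 2 / (x ⬝ᵥ x) + ∑ j, orthGauss x G i j ^ 2 := by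
    have h : Y.row i ⬝ᵥ Y.row i = (Y * Yᵀ) i i := rfl
    have h' : (canonicalBasis x G * (canonicalBasis x G)ᵀ) i i =
      canonicalBasis x G i ⬝ᵥ canonicalBasis x G i := rfl
    rw [h, hY.mul_transpose_eq hB, h', ← l2norm_sq x, dotProduct, Fin.sum_univ_succ]
    simp only [canonicalBasis, Matrix.of_apply, Fin.cons_zero, Fin.cons_succ]
    simp only [sq]
    rw [div_mul_div_comm]
  have hqq : q ⬝ᵥ q = 1 := by rw [← l2norm_sq, hq1, one_pow]
  -- `Y` has orthonormal columns, hence is an isometry, and `q` is a unit vector.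
  have hxx : x ⬝ᵥ x = γ ^ 2 := by
    have : (Y *ᵥ q) ⬝ᵥ (Y *ᵥ q) = 1 := by
      rw [Matrix.dotProduct_mulVec, ← Matrix.mulVec_transpose, Matrix.mulVec_mulVec, hY.1,
        Matrix.one_mulVec, hqq]
    rw [hxq, smul_dotProduct, dotProduct_smul, this]
    simp [sq]
  have hrow : Y.row i ⬝ᵥ q = x i / γ := by
    have : x i = γ * (Y.row i ⬝ᵥ q) := congrFun hxq i
    rw [this]; field_simp
  rw [initVec, smul_dotProduct, hrow, l2norm_eq_sqrt, hdiag, hxx, Real.sqrt_sq_eq_abs, smul_eq_mul,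
    abs_mul, abs_div, abs_of_nonneg (inv_nonneg.2 (Real.sqrt_nonneg _)), ← hxx]

/-- Makes the claim about `e₁` a special case of the claim about arbitrary bases and targets. -/
lemma isTarget_canonicalBasis {p m : ℕ} {x : Fin p → ℝ} (hx : x ≠ 0)
    (G : Matrix (Fin p) (Fin m) ℝ) : IsTarget (canonicalBasis x G) x (Pi.single 0 1) := by
  refine ⟨?_, l2norm x, (l2norm_pos hx).ne', ?_⟩
  · rw [l2norm_eq_sqrt]; simp
  · rw [Matrix.mulVec_single_one, canonicalBasis_col_zero, smul_smul,
      mul_inv_cancel₀ (l2norm_pos hx).ne', one_smul]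

/-- Apply the lower bound to `w = A^(-1/2) u`, for which `w ⬝ᵥ A w = u ⬝ᵥ u`. -/
lemma sum_sq_vecMul_invSqrt_le {m : ℕ} {A : Matrix (Fin m) (Fin m) ℝ} (hA : A.PosDef) {lam : ℝ}
    (hlam : 0 < lam) (h : ∀ a, lam * (a ⬝ᵥ a) ≤ a ⬝ᵥ (A *ᵥ a)) (u : Fin m → ℝ) :
    (u ᵥ* invSqrt A) ⬝ᵥ (u ᵥ* invSqrt A) ≤ (u ⬝ᵥ u) / lam := by
  rw [le_div_iff₀' hlam]
  refine (h _).trans_eq ?_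
  have : (u ᵥ* invSqrt A) ⬝ᵥ (A *ᵥ (u ᵥ* invSqrt A)) = u ⬝ᵥ ((invSqrt A * A * invSqrt A) *ᵥ u) := by
    rw [← Matrix.dotProduct_mulVec, ← Matrix.mulVec_transpose, invSqrt_transpose,
      Matrix.mulVec_mulVec, Matrix.mulVec_mulVec, Matrix.mul_assoc]
  rw [this, invSqrt_mul_mul_invSqrt hA, Matrix.one_mulVec]

/-- Here `K` is the support size, `K * v ^ 2` is `‖x‖²` and `s` is the squared norm of a row of
`orthGauss`; scaling the squared row norm by `K` gives at most `1 + F`. -/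
lemma inv_sqrt_one_add_le {K v s F : ℝ} (hK : 0 < K) (hv : v ≠ 0) (hs : 0 ≤ s)
    (hle : s ≤ F / K) :
    (√(1 + F))⁻¹ ≤ (√(v ^ 2 / (K * v ^ 2) + s))⁻¹ * (|v| / √(K * v ^ 2)) := by
  have h1 : v ^ 2 / (K * v ^ 2) = 1 / K := by field_simp
  have h2 : |v| / √(K * v ^ 2) = (√K)⁻¹ := by
    rw [Real.sqrt_mul hK.le, Real.sqrt_sq_eq_abs]
    have : |v| ≠ 0 := abs_ne_zero.2 hv
    field_simp
  rw [h1, h2, ← mul_inv, ← Real.sqrt_mul (by positivity)]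
  refine inv_anti₀ (Real.sqrt_pos.2 (by positivity)) (Real.sqrt_le_sqrt ?_)
  calc (1 / K + s) * K ≤ (1 / K + F / K) * K := by gcongr
    _ = 1 + F := by field_simp

/-! ### Deterministic bound for a flat vector. -/

section planted
variable {p m : ℕ} {x : Fin p → ℝ} {G : Matrix (Fin p) (Fin m) ℝ} {I : Finset (Fin p)} {v : ℝ}

lemma dotProduct_self_of_support (hx : ∀ i, x i = if i ∈ I then v else 0) :
    x ⬝ᵥ x = I.card * v ^ 2 := by
  simp [dotProduct, hx, sq]

/-- On the rows in `I` the projection subtracts from each column its mean over `I`, and centring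
never increases a sum of squares. -/
lemma sum_sq_projPerp_mul_le (hv : v ≠ 0) (hI : I.Nonempty)
    (hx : ∀ i, x i = if i ∈ I then v else 0) :
    ∑ i ∈ I, ∑ j, (projPerp x * G) i j ^ 2 ≤ ∑ i ∈ I, ∑ j, G i j ^ 2 := by
  rw [Finset.sum_comm, Finset.sum_comm (s := I)]
  refine Finset.sum_le_sum fun j _ => ?_
  have hK : (0 : ℝ) < I.card := by exact_mod_cast hI.card_pos
  have hxG : x ⬝ᵥ G.col j = v * ∑ i ∈ I, G i j := by
    simp [dotProduct, hx, Finset.mul_sum, Matrix.col]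
  have h (i : Fin p) (hi : i ∈ I) :
      (projPerp x * G) i j = G i j - (∑ i ∈ I, G i j) / I.card := by
    have := congrFun (col_projPerp_mul (x := x) (G := G) j) i
    rw [hxG, dotProduct_self_of_support hx] at this
    simp only [Matrix.col, Matrix.transpose_apply, Pi.sub_apply, Pi.smul_apply, smul_eq_mul,
      hx i, if_pos hi] at this
    rw [this]
    field_simp
  rw [Finset.sum_congr rfl fun i hi => by rw [h i hi]]
  simp only [sub_sq, Finset.sum_add_distrib, Finset.sum_sub_distrib, ← Finset.sum_mul,
    ← Finset.mul_sum, Finset.sum_const, nsmul_eq_mul]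
  have h0 : 0 ≤ (∑ i ∈ I, G i j) ^ 2 / I.card := by positivity
  have h1 : (I.card : ℝ) * ((∑ i ∈ I, G i j) / I.card) ^ 2 = (∑ i ∈ I, G i j) ^ 2 / I.card := by
    field_simp
  have h2 : 2 * (∑ i ∈ I, G i j) * ((∑ i ∈ I, G i j) / I.card) =
      2 * ((∑ i ∈ I, G i j) ^ 2 / I.card) := by ring
  rw [h1, h2]
  linarith

lemma orthonormal_and_correlation (hv : v ≠ 0) (hI : I.Nonempty)
    (hx : ∀ i, x i = if i ∈ I then v else 0) {lam F : ℝ} (hlam : 0 < lam)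
    (hG : ∀ a, lam * (a ⬝ᵥ a) ≤
      (G *ᵥ a) ⬝ᵥ (G *ᵥ a) - (x ⬝ᵥ x)⁻¹ * (x ⬝ᵥ (G *ᵥ a)) ^ 2)
    (hF : ∑ i ∈ I, ∑ j, G i j ^ 2 ≤ F) :
    IsOrthonormalBasisOf (canonicalBasis x G) (plantedSubspace x G) ∧
      ∃ i, ∀ (Y : Matrix (Fin p) (Fin (m + 1)) ℝ) (q : Fin (m + 1) → ℝ),
        IsOrthonormalBasisOf Y (plantedSubspace x G) → IsTarget Y x q →
          (√(1 + F / lam))⁻¹ ≤ |initVec Y i ⬝ᵥ q| := by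
  have hK : (0 : ℝ) < I.card := by exact_mod_cast hI.card_pos
  have hxx := dotProduct_self_of_support hx
  have hx0 : x ≠ 0 := by
    obtain ⟨i, hi⟩ := hI
    intro h
    have := hx i
    rw [h, if_pos hi] at this
    exact hv this.symm
  set A := Gᵀ * projPerp x * G with hAdef
  have hquad (a) : lam * (a ⬝ᵥ a) ≤ a ⬝ᵥ (A *ᵥ a) := by
    rw [hAdef, gram_quadratic]
    exact hG a
  have hA : A.PosDef := by
    refine Matrix.PosDef.of_dotProduct_mulVec_pos ?_ fun a ha => ?_
    · rw [Matrix.IsHermitian, Matrix.conjTranspose_eq_transpose_of_trivial, hAdef,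
        Matrix.transpose_mul, Matrix.transpose_mul, Matrix.transpose_transpose,
        projPerp_transpose, Matrix.mul_assoc]
    · rw [star_trivial]
      exact (mul_pos hlam (dotProduct_self_pos ha)).trans_le (hquad a)
  have hB : IsOrthonormalBasisOf (canonicalBasis x G) (plantedSubspace x G) :=
    ⟨canonicalBasis_orthonormal hx0 hA, canonicalBasis_span hx0 hA⟩
  refine ⟨hB, ?_⟩
  have hsum : ∑ i ∈ I, ∑ j, orthGauss x G i j ^ 2 ≤ F / lam := by
    calc ∑ i ∈ I, ∑ j, orthGauss x G i j ^ 2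
        ≤ ∑ i ∈ I, (∑ j, (projPerp x * G) i j ^ 2) / lam := by
          refine Finset.sum_le_sum fun i _ => ?_
          have := sum_sq_vecMul_invSqrt_le hA hlam hquad ((projPerp x * G) i)
          simp only [dotProduct, ← sq] at this
          exact this
      _ = (∑ i ∈ I, ∑ j, (projPerp x * G) i j ^ 2) / lam := by rw [Finset.sum_div]
      _ ≤ F / lam := by
          gcongr
          exact (sum_sq_projPerp_mul_le hv hI hx).trans hF
  -- Averaging over `I`: some row is at most the mean.
  obtain ⟨i, hi, hle⟩ : ∃ i ∈ I, ∑ j, orthGauss x G i j ^ 2 ≤ F / lam / I.card := by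
    refine Finset.exists_le_of_sum_le hI (hsum.trans_eq ?_)
    rw [Finset.sum_const, nsmul_eq_mul]
    field_simp
  refine ⟨i, fun Y q hY hq => ?_⟩
  have hxi : x i = v := by rw [hx, if_pos hi]
  rw [abs_initVec_dotProduct_target hx0 hB hY hq, hxi, hxx]
  exact inv_sqrt_one_add_le hK hv (Finset.sum_nonneg fun _ _ => sq_nonneg _) hle

end planted

/-! ### Nets of the unit sphere. -/

section net
variable {E : Type*} [NormedAddCommGroup E] [NormedSpace ℝ E] [FiniteDimensional ℝ E]

/-- The volume bound for separated subsets of the unit ball. -/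
lemma card_le_of_separated_unit {ε : ℝ} (hε : 0 < ε) (s : Finset E) (hs : ∀ c ∈ s, ‖c‖ ≤ 1)
    (h : ∀ c ∈ s, ∀ d ∈ s, c ≠ d → ε ≤ ‖c - d‖) :
    (s.card : ℝ) ≤ (1 + 2 / ε) ^ Module.finrank ℝ E := by
  borelize E
  let μ : Measure E := Measure.addHaar
  have hδ : 0 < ε / 2 := by positivity
  have hρ : 0 < 1 + ε / 2 := by positivity
  -- Balls of radius `ε / 2` about separated points are disjoint and fit in the ball of radius `1 +
  -- ε / 2`; comparing volumes bounds their number.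
  have hdisj : Set.Pairwise (s : Set E) (Function.onFun Disjoint fun c => Metric.ball c (ε / 2)) := by
    rintro c hc d hd hcd
    apply Metric.ball_disjoint_ball
    rw [dist_eq_norm, add_halves]
    exact h c hc d hd hcd
  have hsub : (⋃ c ∈ s, Metric.ball c (ε / 2)) ⊆ Metric.ball (0 : E) (1 + ε / 2) := by
    refine Set.iUnion₂_subset fun x hx => Metric.ball_subset_ball' ?_
    rw [dist_zero_right, add_comm]
    exact add_le_add_left (hs x hx) _
  have hvol : (s.card : ENNReal) * ENNReal.ofReal ((ε / 2) ^ Module.finrank ℝ E) *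
      μ (Metric.ball 0 1) ≤
      ENNReal.ofReal ((1 + ε / 2) ^ Module.finrank ℝ E) * μ (Metric.ball 0 1) := by
    calc _ = μ (⋃ c ∈ s, Metric.ball c (ε / 2)) := by
          rw [measure_biUnion_finset hdisj fun c _ => measurableSet_ball]
          simp only [μ.addHaar_ball_of_pos _ hδ, Finset.sum_const, nsmul_eq_mul, mul_assoc]
      _ ≤ μ (Metric.ball (0 : E) (1 + ε / 2)) := measure_mono hsub
      _ = _ := by rw [μ.addHaar_ball_of_pos _ hρ]
  have hle := (ENNReal.mul_le_mul_iff_left (Metric.measure_ball_pos _ _ zero_lt_one).ne'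
    measure_ball_lt_top.ne).1 hvol
  have hreal := ENNReal.toReal_le_of_le_ofReal (pow_nonneg hρ.le _) hle
  rw [ENNReal.toReal_mul, ENNReal.toReal_natCast, ENNReal.toReal_ofReal (by positivity)] at hreal
  rw [← le_div_iff₀ (by positivity), ← div_pow] at hreal
  have h2 : 1 + 2 / ε = (1 + ε / 2) / (ε / 2) := by
    field_simp
    ring
  rwa [h2]

/-- A separated subset of the sphere of maximal cardinality is a net, since an uncovered point could
be added to it. -/
lemma exists_net_sphere {ε : ℝ} (hε : 0 < ε) :
    ∃ s : Finset E, (∀ c ∈ s, ‖c‖ = 1) ∧ (∀ x : E, ‖x‖ = 1 → ∃ c ∈ s, ‖x - c‖ ≤ ε) ∧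
      (s.card : ℝ) ≤ (1 + 2 / ε) ^ Module.finrank ℝ E := by
  classical
  let Q : Finset E → Prop := fun s =>
    (∀ c ∈ s, ‖c‖ = 1) ∧ ∀ c ∈ s, ∀ d ∈ s, c ≠ d → ε ≤ ‖c - d‖
  have hQ (s) (hs : Q s) : (s.card : ℝ) ≤ (1 + 2 / ε) ^ Module.finrank ℝ E :=
    card_le_of_separated_unit hε s (fun c hc => (hs.1 c hc).le) hs.2
  obtain ⟨N, hN⟩ := exists_nat_ge ((1 + 2 / ε) ^ Module.finrank ℝ E)
  have hbdd : BddAbove {k | ∃ s, Q s ∧ s.card = k} := by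
    refine ⟨N, ?_⟩
    rintro _ ⟨s, hs, rfl⟩
    exact_mod_cast (hQ s hs).trans hN
  have hne : {k | ∃ s, Q s ∧ s.card = k}.Nonempty := ⟨0, ∅, by simp [Q], by simp⟩
  obtain ⟨s, hs, hcard⟩ := Nat.sSup_mem hne hbdd
  refine ⟨s, hs.1, fun x hx => ?_, hQ s hs⟩
  by_contra! hcon
  have hxs : x ∉ s := fun h => by
    have := hcon x h
    simp only [sub_self, norm_zero] at this
    linarith
  have hQ' : Q (insert x s) := by
    refine ⟨?_, ?_⟩
    · intro c hc
      rcases Finset.mem_insert.1 hc with rfl | hc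
      exacts [hx, hs.1 c hc]
    · intro c hc d hd hcd
      rcases Finset.mem_insert.1 hc with rfl | hc' <;>
        rcases Finset.mem_insert.1 hd with rfl | hd'
      · exact absurd rfl hcd
      · exact (hcon d hd').le
      · rw [norm_sub_rev]
        exact (hcon c hc').le
      · exact hs.2 c hc' d hd' hcd
  have h1 := le_csSup hbdd ⟨_, hQ', rfl⟩
  rw [Finset.card_insert_of_notMem hxs, ← hcard] at h1
  omega

end net

/-- Two-sided control of a linear map on a net of the unit sphere bounds it from below. -/
lemma norm_le_of_net {E F : Type*} [NormedAddCommGroup E] [NormedSpace ℝ E]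
    [NormedAddCommGroup F] [NormedSpace ℝ F] (T : E →L[ℝ] F)
    {ε a b : ℝ} (hε0 : 0 ≤ ε) (hε : ε < 1) (hb : 0 ≤ b) {s : Finset E}
    (hs : ∀ x : E, ‖x‖ = 1 → ∃ c ∈ s, ‖x - c‖ ≤ ε)
    (ha : ∀ c ∈ s, a ≤ ‖T c‖) (hb' : ∀ c ∈ s, ‖T c‖ ≤ b) (x : E) :
    (a - ε * b / (1 - ε)) * ‖x‖ ≤ ‖T x‖ := by
  have hclose (x c : E) (h : ‖x - c‖ ≤ ε) : ‖T x - T c‖ ≤ ‖T‖ * ε := by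
    rw [← map_sub]
    exact (T.le_opNorm _).trans (mul_le_mul_of_nonneg_left h (norm_nonneg _))
  have hscale (y : E) (hy : y ≠ 0) : ‖(‖y‖⁻¹ : ℝ) • y‖ = 1 := by
    rw [norm_smul, norm_inv, norm_norm, inv_mul_cancel₀ (norm_ne_zero_iff.2 hy)]
  have hTscale (y : E) : ‖T ((‖y‖⁻¹ : ℝ) • y)‖ = ‖y‖⁻¹ * ‖T y‖ := by
    rw [map_smul, norm_smul, norm_inv, norm_norm]
  -- Self-bounding: this gives `‖T‖ ≤ b / (1 - ε)`, so moving to the nearest net point costs at most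
  -- `ε * b / (1 - ε)`.
  have hop : ‖T‖ ≤ b + ‖T‖ * ε := by
    refine T.opNorm_le_bound (by positivity) fun y => ?_
    rcases eq_or_ne y 0 with rfl | hy
    · simp
    obtain ⟨c, hc, hyc⟩ := hs _ (hscale y hy)
    have h1 := norm_le_norm_add_norm_sub' (T ((‖y‖⁻¹ : ℝ) • y)) (T c)
    have h2 := hclose _ _ hyc
    have h3 := hb' c hc
    rw [hTscale] at h1
    have h4 : ‖y‖⁻¹ * ‖T y‖ ≤ b + ‖T‖ * ε := by linarith
    rwa [inv_mul_le_iff₀ (norm_pos_iff.2 hy), mul_comm] at h4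
  rcases eq_or_ne x 0 with rfl | hx
  · simp
  obtain ⟨c, hc, hxc⟩ := hs _ (hscale x hx)
  have h1 := norm_le_norm_add_norm_sub' (T c) (T ((‖x‖⁻¹ : ℝ) • x))
  have h2 := hclose _ _ hxc
  rw [norm_sub_rev] at h2
  have h3 := ha c hc
  have h5 : ‖T‖ * ε ≤ ε * b / (1 - ε) := by
    rw [le_div_iff₀ (by linarith)]
    nlinarith
  rw [hTscale] at h1
  have h4 : a - ε * b / (1 - ε) ≤ ‖x‖⁻¹ * ‖T x‖ := by linarith
  rwa [le_inv_mul_iff₀ (norm_pos_iff.2 hx), mul_comm] at h4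

/-! ### Gaussian combinations and chi-square tails. -/

section gaussian
variable {Ω : Type*} [MeasurableSpace Ω] {P : Measure Ω} {v : NNReal}

/-- Orthonormal combinations of i.i.d. centred Gaussian variables are again i.i.d. with the same
law. -/
lemma gaussian_orthonormal_comb {κ ι : Type*} [Fintype κ] [Fintype ι] [DecidableEq ι]
    {Z : κ → Ω → ℝ}
    (hZ : ∀ k, HasLaw (Z k) (gaussianReal 0 v) P) (hind : iIndepFun Z P) {W : ι → κ → ℝ}
    (hW : ∀ i i', ∑ k, W i k * W i' k = if i = i' then 1 else 0) :
    iIndepFun (fun i ω => ∑ k, W i k * Z k ω) P ∧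
      ∀ i, HasLaw (fun ω => ∑ k, W i k * Z k ω) (gaussianReal 0 v) P := by
  classical
  have := hind.isProbabilityMeasure
  have hG (k) : HasGaussianLaw (Z k) P := (hZ k).hasGaussianLaw
  have hjoint : HasGaussianLaw (fun ω k => Z k ω) P := hind.hasGaussianLaw hG
  have hmem (i : ι) (k) : MemLp (fun ω => W i k * Z k ω) 2 P := (hG k).memLp_two.const_mul _
  have hvar (k) : cov[Z k, Z k; P] = v := by
    rw [covariance_self (hG k).aemeasurable, (hZ k).variance_eq, variance_id_gaussianReal]
  have hcov0 (k l) : cov[Z k, Z l; P] = if k = l then (v : ℝ) else 0 := by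
    split_ifs with h
    · rw [← h, hvar]
    · exact (hind.indepFun h).covariance_eq_zero (hG k).memLp_two (hG l).memLp_two
  -- Orthonormality keeps the covariance equal to `v` times the identity; for jointly Gaussian
  -- variables, uncorrelated means independent.
  have hcov (i i') : cov[fun ω => ∑ k, W i k * Z k ω, fun ω => ∑ k, W i' k * Z k ω; P] =
      if i = i' then (v : ℝ) else 0 := by
    rw [covariance_fun_sum_fun_sum (hmem i) (hmem i')]
    simp_rw [covariance_const_mul_left, covariance_const_mul_right, hcov0]
    simp only [mul_ite, mul_zero, Finset.sum_ite_eq, Finset.mem_univ, if_true]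
    rw [← one_mul (v : ℝ), ← zero_mul (v : ℝ), ← ite_mul, ← hW, Finset.sum_mul]
    refine Finset.sum_congr rfl fun k _ => by ring
  let L : (κ → ℝ) →L[ℝ] (ι → ℝ) :=
    ContinuousLinearMap.pi fun i => ∑ k, W i k • ContinuousLinearMap.proj k
  have hX : HasGaussianLaw (fun ω i => ∑ k, W i k * Z k ω) P := by
    have : (fun ω i => ∑ k, W i k * Z k ω) = fun ω => L (fun k => Z k ω) := by
      ext ω i
      simp [L]
    rw [this]
    exact hjoint.map_fun L
  refine ⟨hX.iIndepFun_of_covariance_eq_zero fun i j hij => by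
    rw [hcov, if_neg hij], fun i => ⟨hX.aemeasurable.eval i, ?_⟩⟩
  rw [(hX.eval i).map_eq_gaussianReal, ← covariance_self (hX.aemeasurable.eval i), hcov, if_pos rfl,
    Real.toNNReal_coe, integral_finsetSum _ fun k _ => (hmem i k).integrable one_le_two]
  congr 1
  refine Finset.sum_eq_zero fun k _ => ?_
  rw [integral_const_mul, (hZ k).integral_eq, integral_id_gaussianReal, mul_zero]

lemma integrable_and_integral_exp_mul_sq_gaussianReal (hv : v ≠ 0) {t : ℝ} (ht : 2 * t * v < 1) :
    Integrable (fun x => Real.exp (t * x ^ 2)) (gaussianReal 0 v) ∧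
      ∫ x, Real.exp (t * x ^ 2) ∂(gaussianReal 0 v) = (√(1 - 2 * t * v))⁻¹ := by
  have hv0 : (0 : ℝ) < v := by exact_mod_cast pos_iff_ne_zero.2 hv
  set b : ℝ := (1 - 2 * t * v) / (2 * v) with hb
  have hb0 : 0 < b := div_pos (by linarith) (by linarith)
  have hpt (x : ℝ) : gaussianPDFReal 0 v x * Real.exp (t * x ^ 2) =
      (√(2 * Real.pi * v))⁻¹ * Real.exp (-b * x ^ 2) := by
    rw [gaussianPDFReal, mul_assoc, ← Real.exp_add]
    congr 2
    rw [hb]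
    field_simp
    ring
  constructor
  · rw [gaussianReal_of_var_ne_zero _ hv,
      integrable_withDensity_iff_integrable_smul₀' (by fun_prop)
        (Filter.Eventually.of_forall fun x => by simp [gaussianPDF])]
    refine ((integrable_exp_neg_mul_sq hb0).const_mul (√(2 * Real.pi * v))⁻¹).congr
      (Filter.Eventually.of_forall fun x => ?_)
    simp only [smul_eq_mul, toReal_gaussianPDF]
    rw [hpt]
  · rw [integral_gaussianReal_eq_integral_smul hv]
    simp only [smul_eq_mul, hpt]
    rw [integral_const_mul, integral_gaussian, ← Real.sqrt_inv, ← Real.sqrt_inv,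
      ← Real.sqrt_mul (by positivity)]
    congr 1
    rw [hb]
    have : 1 - 2 * t * v ≠ 0 := by linarith
    field_simp

variable {ι : Type*} {X : ι → Ω → ℝ}

lemma integrable_and_mgf_sum_sq (hv : v ≠ 0) (hX : ∀ i, HasLaw (X i) (gaussianReal 0 v) P)
    (hind : iIndepFun X P) {t : ℝ} (ht : 2 * t * v < 1) (s : Finset ι) :
    Integrable (fun ω => Real.exp (t * ∑ i ∈ s, X i ω ^ 2)) P ∧
      mgf (fun ω => ∑ i ∈ s, X i ω ^ 2) P t = (√(1 - 2 * t * v))⁻¹ ^ s.card := by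
  have hprob := hind.isProbabilityMeasure
  have hind2 : iIndepFun (fun i ω => X i ω ^ 2) P :=
    hind.comp (fun _ x => x ^ 2) fun _ => by fun_prop
  have hmeas (i) : AEMeasurable (fun ω => X i ω ^ 2) P := (hX i).aemeasurable.pow_const 2
  have h1 := integrable_and_integral_exp_mul_sq_gaussianReal hv ht
  have hm (i) : mgf (fun ω => X i ω ^ 2) P t = (√(1 - 2 * t * v))⁻¹ := by
    rw [← h1.2, mgf]
    exact (hX i).integral_comp (f := fun x => Real.exp (t * x ^ 2)) h1.1.aestronglyMeasurable
  have hmgf : mgf (fun ω => ∑ i ∈ s, X i ω ^ 2) P t = (√(1 - 2 * t * v))⁻¹ ^ s.card := by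
    have h := hind2.mgf_sum₀ (t := t) hmeas s
    rw [Finset.prod_congr rfl fun i _ => hm i, Finset.prod_const] at h
    rw [← h]
    congr 1
    ext ω
    simp
  refine ⟨?_, hmgf⟩
  -- A non-integrable function has integral `0` by convention, whereas the moment generating
  -- function just computed is positive.
  by_contra hcon
  have : mgf (fun ω => ∑ i ∈ s, X i ω ^ 2) P t = 0 := integral_undef hcon
  rw [hmgf] at this
  have h0 : 0 < √(1 - 2 * t * v) := Real.sqrt_pos.2 (by linarith)
  exact (pow_pos (inv_pos.2 h0) _).ne' this

/-- Chernoff bound at `t = 3 / (8 v)`, chosen so that `1 - 2 t v = 1/4` and each variable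
contributes a factor `2`. -/
lemma measure_sum_sq_ge_le (hv : v ≠ 0) (hX : ∀ i, HasLaw (X i) (gaussianReal 0 v) P)
    (hind : iIndepFun X P) (s : Finset ι) (u : ℝ) :
    P.real {ω | u ≤ ∑ i ∈ s, X i ω ^ 2} ≤ Real.exp (-(3 / 8) * (u / v)) * 2 ^ s.card := by
  have hprob := hind.isProbabilityMeasure
  have hv0 : (0 : ℝ) < v := by exact_mod_cast pos_iff_ne_zero.2 hv
  have hs : 1 - 2 * (3 / (8 * (v : ℝ))) * v = (2⁻¹) ^ 2 := by
    field_simp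
    norm_num
  have h := integrable_and_mgf_sum_sq hv hX hind (t := 3 / (8 * v))
    (by have := sq_nonneg (2⁻¹ : ℝ); norm_num at hs; linarith) s
  refine (measure_ge_le_exp_mul_mgf u (by positivity) h.1).trans_eq ?_
  rw [h.2, hs, Real.sqrt_sq (by positivity), inv_inv]
  congr 2
  field_simp

/-- Chernoff bound at `t = -4 / v`, where `1 - 2 t v = 9` and each variable contributes a factor
`1/3`. -/
lemma measure_sum_sq_le_le (hv : v ≠ 0) (hX : ∀ i, HasLaw (X i) (gaussianReal 0 v) P)
    (hind : iIndepFun X P) (s : Finset ι) (u : ℝ) :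
    P.real {ω | ∑ i ∈ s, X i ω ^ 2 ≤ u} ≤ Real.exp (4 * (u / v)) * 3⁻¹ ^ s.card := by
  have hprob := hind.isProbabilityMeasure
  have hv0 : (0 : ℝ) < v := by exact_mod_cast pos_iff_ne_zero.2 hv
  have hs : 1 - 2 * (-4 / (v : ℝ)) * v = 3 ^ 2 := by
    field_simp
    norm_num
  have h := integrable_and_mgf_sum_sq hv hX hind (t := -4 / v) (by norm_num at hs; linarith) s
  refine (measure_le_le_exp_mul_mgf u
    (div_nonpos_of_nonpos_of_nonneg (by norm_num) hv0.le) h.1).trans_eq ?_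
  rw [h.2, hs, Real.sqrt_sq (by positivity)]
  congr 2
  field_simp

end gaussian

/-! ### Concentration for Gaussian matrices. -/

section gaussianMatrix
variable {Ω : Type*} [MeasurableSpace Ω] {P : Measure Ω} {p m : ℕ}
  {G : Ω → Matrix (Fin p) (Fin m) ℝ}

/-- The entries of `G` are i.i.d. with law `N(0, 1/p)`. -/
structure IsGaussianMatrix (P : Measure Ω) (G : Ω → Matrix (Fin p) (Fin m) ℝ) : Prop where
  law : ∀ k : Fin p × Fin m, HasLaw (fun ω => G ω k.1 k.2) (gaussianReal 0 (1 / (p : NNReal))) P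
  indep : iIndepFun (fun (k : Fin p × Fin m) ω => G ω k.1 k.2) P

lemma coe_one_div_natCast (p : ℕ) : ((1 / (p : NNReal) : NNReal) : ℝ) = 1 / (p : ℝ) := by
  push_cast
  rfl

namespace IsGaussianMatrix

lemma mulVec (h : IsGaussianMatrix P G) {a : Fin m → ℝ} (ha : a ⬝ᵥ a = 1) :
    iIndepFun (fun i ω => (G ω *ᵥ a) i) P ∧
      ∀ i, HasLaw (fun ω => (G ω *ᵥ a) i) (gaussianReal 0 (1 / (p : NNReal))) P := by
  -- The weights place a copy of `a` in row `i`; different `i` have disjoint supports.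
  have key := gaussian_orthonormal_comb h.law h.indep
    (W := fun (i : Fin p) k => if i = k.1 then a k.2 else 0) (fun i i' => by
      rw [Fintype.sum_prod_type, Finset.sum_eq_single i (fun b _ hb => by simp [hb.symm])
        (by simp)]
      by_cases hi : i = i'
      · subst hi
        simpa [dotProduct] using ha
      · simp [hi, Ne.symm hi])
  have heq (i : Fin p) (ω) : ∑ k : Fin p × Fin m, (if i = k.1 then a k.2 else 0) * G ω k.1 k.2 =
      (G ω *ᵥ a) i := by
    rw [Fintype.sum_prod_type, Finset.sum_eq_single i (fun b _ hb => by simp [hb.symm]) (by simp)]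
    simp [Matrix.mulVec, dotProduct, mul_comm]
  simpa only [heq] using key

lemma vecMul (h : IsGaussianMatrix P G) {x : Fin p → ℝ} (hx : x ⬝ᵥ x = 1) :
    iIndepFun (fun j ω => (x ᵥ* G ω) j) P ∧
      ∀ j, HasLaw (fun ω => (x ᵥ* G ω) j) (gaussianReal 0 (1 / (p : NNReal))) P := by
  have key := gaussian_orthonormal_comb h.law h.indep
    (W := fun (j : Fin m) k => if j = k.2 then x k.1 else 0) (fun i i' => by
      rw [Fintype.sum_prod_type_right, Finset.sum_eq_single i
        (fun b _ hb => by simp [hb.symm]) (by simp)]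
      by_cases hi : i = i'
      · subst hi
        simpa [dotProduct] using hx
      · simp [hi, Ne.symm hi])
  have heq (j : Fin m) (ω) : ∑ k : Fin p × Fin m, (if j = k.2 then x k.1 else 0) * G ω k.1 k.2 =
      (x ᵥ* G ω) j := by
    rw [Fintype.sum_prod_type_right, Finset.sum_eq_single j
      (fun b _ hb => by simp [hb.symm]) (by simp)]
    simp [Matrix.vecMul, dotProduct]
  simpa only [heq] using key

lemma measure_mulVec_ge (h : IsGaussianMatrix P G) (hp : p ≠ 0) {a : Fin m → ℝ}
    (ha : a ⬝ᵥ a = 1) :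
    P.real {ω | 4 ≤ (G ω *ᵥ a) ⬝ᵥ (G ω *ᵥ a)} ≤ Real.exp (-(3 / 2) * p) * 2 ^ p := by
  obtain ⟨h1, h2⟩ := h.mulVec ha
  have := measure_sum_sq_ge_le (by positivity) h2 h1 Finset.univ 4
  rw [coe_one_div_natCast, Finset.card_univ, Fintype.card_fin] at this
  simp only [dotProduct, ← sq]
  refine this.trans_eq ?_
  congr 2
  field_simp
  norm_num

lemma measure_mulVec_le (h : IsGaussianMatrix P G) (hp : p ≠ 0) {a : Fin m → ℝ}
    (ha : a ⬝ᵥ a = 1) :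
    P.real {ω | (G ω *ᵥ a) ⬝ᵥ (G ω *ᵥ a) ≤ 1 / 4} ≤ Real.exp p * 3⁻¹ ^ p := by
  obtain ⟨h1, h2⟩ := h.mulVec ha
  have := measure_sum_sq_le_le (by positivity) h2 h1 Finset.univ (1 / 4)
  rw [coe_one_div_natCast, Finset.card_univ, Fintype.card_fin] at this
  simp only [dotProduct, ← sq]
  refine this.trans_eq ?_
  congr 2
  field_simp

lemma measure_vecMul_ge (h : IsGaussianMatrix P G) (hp : p ≠ 0) {x : Fin p → ℝ} (hx : x ≠ 0) :
    P.real {ω | 2 / 45 * (x ⬝ᵥ x) ≤ (x ᵥ* G ω) ⬝ᵥ (x ᵥ* G ω)} ≤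
      Real.exp (-(p / 60)) * 2 ^ m := by
  have hxx := dotProduct_self_pos hx
  set r : ℝ := (√(x ⬝ᵥ x))⁻¹ with hr
  have hrr : r * r = (x ⬝ᵥ x)⁻¹ := by rw [hr, ← mul_inv, Real.mul_self_sqrt hxx.le]
  have hunit : (r • x) ⬝ᵥ (r • x) = 1 := by
    rw [smul_dotProduct, dotProduct_smul, smul_smul, hrr, smul_eq_mul, inv_mul_cancel₀ hxx.ne']
  obtain ⟨h1, h2⟩ := h.vecMul hunit
  have := measure_sum_sq_ge_le (by positivity) h2 h1 Finset.univ (2 / 45)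
  rw [coe_one_div_natCast, Finset.card_univ, Fintype.card_fin] at this
  have heq (ω) : ∑ j, ((r • x) ᵥ* G ω) j ^ 2 =
      (x ⬝ᵥ x)⁻¹ * ((x ᵥ* G ω) ⬝ᵥ (x ᵥ* G ω)) := by
    rw [Matrix.smul_vecMul, ← hrr, dotProduct, Finset.mul_sum]
    refine Finset.sum_congr rfl fun j _ => ?_
    rw [Pi.smul_apply, smul_eq_mul]
    ring
  simp only [heq, le_inv_mul_iff₀ hxx, mul_comm (x ⬝ᵥ x)] at this
  refine this.trans_eq ?_
  congr 2
  field_simp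
  norm_num

lemma measure_sum_rows_ge (h : IsGaussianMatrix P G) (hp : p ≠ 0) (I : Finset (Fin p)) (u : ℝ) :
    P.real {ω | u ≤ ∑ i ∈ I, ∑ j, G ω i j ^ 2} ≤
      Real.exp (-(3 / 8) * (u * p)) * 2 ^ (I.card * m) := by
  have := measure_sum_sq_ge_le (by positivity) h.law h.indep (I ×ˢ Finset.univ) u
  simp only [coe_one_div_natCast, Finset.card_product, Finset.card_univ, Fintype.card_fin,
    Finset.sum_product, div_div_eq_mul_div, div_one] at this
  exact this

lemma measure_not_lower_bound_le [IsProbabilityMeasure P] (h : IsGaussianMatrix P G)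
    (hp : p ≠ 0) :
    P.real {ω | ¬ ∀ a, 1 / 9 * (a ⬝ᵥ a) ≤ (G ω *ᵥ a) ⬝ᵥ (G ω *ᵥ a)} ≤
      33 ^ m * (Real.exp (-(3 / 2) * p) * 2 ^ p + Real.exp p * 3⁻¹ ^ p) := by
  obtain ⟨s, hs1, hsnet, hcard⟩ :=
    exists_net_sphere (E := EuclideanSpace ℝ (Fin m)) (ε := 1 / 16) (by norm_num)
  have hcard' : (s.card : ℝ) ≤ 33 ^ m := by
    refine hcard.trans_eq ?_
    rw [finrank_euclideanSpace_fin]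
    norm_num
  have hdot {k : ℕ} (v : EuclideanSpace ℝ (Fin k)) : ‖v‖ ^ 2 = v.ofLp ⬝ᵥ v.ofLp := l2norm_sq v.ofLp
  have hsub : {ω | ¬ ∀ a, 1 / 9 * (a ⬝ᵥ a) ≤ (G ω *ᵥ a) ⬝ᵥ (G ω *ᵥ a)} ⊆
      ⋃ c ∈ s, ({ω | 4 ≤ (G ω *ᵥ c.ofLp) ⬝ᵥ (G ω *ᵥ c.ofLp)} ∪
        {ω | (G ω *ᵥ c.ofLp) ⬝ᵥ (G ω *ᵥ c.ofLp) ≤ 1 / 4}) := by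
    intro ω hω
    by_contra hcon
    simp only [Set.mem_iUnion, Set.mem_union, Set.mem_ofPred_eq, not_exists, not_or, not_le] at hcon
    refine hω fun a => ?_
    let T : EuclideanSpace ℝ (Fin m) →L[ℝ] EuclideanSpace ℝ (Fin p) :=
      LinearMap.toContinuousLinearMap (Matrix.toLpLin 2 2 (G ω))
    have hT (v : EuclideanSpace ℝ (Fin m)) :
        ‖T v‖ ^ 2 = (G ω *ᵥ v.ofLp) ⬝ᵥ (G ω *ᵥ v.ofLp) := by
      rw [hdot]
      rfl
    -- Net constants: `1/2 - (1/16 * 2) / (15/16) = 11/30 ≥ 1/3`, and the net has at most `(1 + 2 *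
    -- 16)^m = 33^m` points.
    have hlow := norm_le_of_net T (ε := 1 / 16) (a := 1 / 2) (b := 2) (by norm_num) (by norm_num)
      (by norm_num) hsnet
      (fun c hc => by
        refine (sq_le_sq₀ (by norm_num) (norm_nonneg _)).1 ?_
        rw [hT]
        have := (hcon c hc).2
        norm_num at this ⊢
        exact this.le)
      (fun c hc => by
        refine (sq_le_sq₀ (norm_nonneg _) (by norm_num)).1 ?_
        rw [hT]
        have := (hcon c hc).1
        norm_num at this ⊢
        exact this.le) (WithLp.toLp 2 a)
    have h3 : 1 / 3 * ‖(WithLp.toLp 2 a : EuclideanSpace ℝ (Fin m))‖ ≤ ‖T (WithLp.toLp 2 a)‖ :=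
      (mul_le_mul_of_nonneg_right (by norm_num) (norm_nonneg _)).trans hlow
    have h4 := pow_le_pow_left₀ (by positivity) h3 2
    rw [mul_pow, hT, hdot] at h4
    norm_num at h4 ⊢
    exact h4
  calc P.real {ω | ¬ ∀ a, 1 / 9 * (a ⬝ᵥ a) ≤ (G ω *ᵥ a) ⬝ᵥ (G ω *ᵥ a)}
      ≤ _ := measureReal_mono hsub (measure_ne_top _ _)
    _ ≤ ∑ c ∈ s, P.real ({ω | 4 ≤ (G ω *ᵥ c.ofLp) ⬝ᵥ (G ω *ᵥ c.ofLp)} ∪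
        {ω | (G ω *ᵥ c.ofLp) ⬝ᵥ (G ω *ᵥ c.ofLp) ≤ 1 / 4}) := measureReal_biUnion_finset_le _ _
    _ ≤ ∑ c ∈ s, (Real.exp (-(3 / 2) * p) * 2 ^ p + Real.exp p * 3⁻¹ ^ p) := by
        refine Finset.sum_le_sum fun c hc => (measureReal_union_le _ _).trans ?_
        have hc1 : c.ofLp ⬝ᵥ c.ofLp = 1 := by rw [← hdot, hs1 c hc, one_pow]
        exact add_le_add (h.measure_mulVec_ge hp hc1) (h.measure_mulVec_le hp hc1)
    _ ≤ _ := by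
        rw [Finset.sum_const, nsmul_eq_mul]
        exact mul_le_mul_of_nonneg_right hcard' (by positivity)

end IsGaussianMatrix

end gaussianMatrix

/-! ### Numerical estimates of the failure probabilities. -/

section numerics

lemma two_pow_le_exp (k : ℕ) : (2 : ℝ) ^ k ≤ Real.exp (7 / 10 * k) := by
  rw [mul_comm, Real.exp_nat_mul]
  refine pow_le_pow_left₀ (by norm_num) ?_ k
  rw [← Real.log_le_iff_le_exp (by norm_num)]
  linarith [Real.log_two_lt_d9]

lemma thirty_three_pow_le_exp (k : ℕ) : (33 : ℝ) ^ k ≤ Real.exp (4 * k) := by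
  rw [mul_comm, Real.exp_nat_mul]
  refine pow_le_pow_left₀ (by norm_num) ?_ k
  have h : Real.exp 4 = Real.exp 1 ^ 4 := by rw [← Real.exp_nat_mul]; norm_num
  rw [h]
  calc (33 : ℝ) ≤ 2.7 ^ 4 := by norm_num
    _ ≤ _ := pow_le_pow_left₀ (by norm_num) (by linarith [Real.exp_one_gt_d9]) 4

/-- A rate above `1` is needed to beat the factor `exp p` in the lower tail; the surplus `p / 20`
also absorbs the net factor, since `4 m ≤ p / 250`. -/
lemma inv_three_pow_le_exp (k : ℕ) : (3⁻¹ : ℝ) ^ k ≤ Real.exp (-(21 / 20) * k) := by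
  rw [mul_comm, Real.exp_nat_mul]
  refine pow_le_pow_left₀ (by norm_num) ?_ k
  rw [Real.exp_neg]
  refine inv_anti₀ (Real.exp_pos _) ?_
  have h : Real.exp (21 / 20) = Real.exp 1 * Real.exp (1 / 20) := by
    rw [← Real.exp_add]; norm_num
  have h2 : Real.exp (1 / 20) ≤ 20 / 19 := by
    have := Real.add_one_le_exp (-(1 / 20) : ℝ)
    rw [Real.exp_neg] at this
    have h3 := inv_anti₀ (by norm_num) this
    rw [inv_inv] at h3
    norm_num at h3 ⊢
    exact h3
  rw [h]
  nlinarith [Real.exp_one_lt_d9, Real.exp_pos 1, Real.exp_pos (1 / 20)]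

variable {p m : ℕ}

lemma sqrt_le_natCast (p : ℕ) : √(p : ℝ) ≤ p := by
  rcases Nat.eq_zero_or_pos p with rfl | hp
  · simp
  · have : (1 : ℝ) ≤ p := by exact_mod_cast hp
    rw [Real.sqrt_le_left (by positivity)]
    nlinarith

lemma net_failure_le (hpm : 1000 * ((m : ℝ) + 1) ≤ p) :
    33 ^ m * (Real.exp (-(3 / 2) * p) * 2 ^ p + Real.exp p * 3⁻¹ ^ p) ≤
      2 * Real.exp (-(√p / 100)) := by
  have hs := sqrt_le_natCast p
  have hp0 : (0 : ℝ) ≤ p := p.cast_nonneg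
  have h1 : (33 : ℝ) ^ m * (Real.exp (-(3 / 2) * p) * 2 ^ p) ≤ Real.exp (-(√p / 100)) := by
    calc (33 : ℝ) ^ m * (Real.exp (-(3 / 2) * p) * 2 ^ p)
        ≤ Real.exp (4 * m) * (Real.exp (-(3 / 2) * p) * Real.exp (7 / 10 * p)) := by
          gcongr
          exacts [thirty_three_pow_le_exp m, two_pow_le_exp p]
      _ ≤ _ := by
          rw [← Real.exp_add, ← Real.exp_add]
          exact Real.exp_le_exp.2 (by linarith)
  have h2 : (33 : ℝ) ^ m * (Real.exp p * 3⁻¹ ^ p) ≤ Real.exp (-(√p / 100)) := by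
    calc (33 : ℝ) ^ m * (Real.exp p * 3⁻¹ ^ p)
        ≤ Real.exp (4 * m) * (Real.exp p * Real.exp (-(21 / 20) * p)) := by
          gcongr
          exacts [thirty_three_pow_le_exp m, inv_three_pow_le_exp p]
      _ ≤ _ := by
          rw [← Real.exp_add, ← Real.exp_add]
          exact Real.exp_le_exp.2 (by linarith)
  rw [mul_add]
  linarith

lemma vecMul_failure_le (hpm : 1000 * ((m : ℝ) + 1) ≤ p) :
    Real.exp (-((p : ℝ) / 60)) * 2 ^ m ≤ Real.exp (-(√p / 100)) := by
  have hs := sqrt_le_natCast p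
  calc Real.exp (-((p : ℝ) / 60)) * 2 ^ m ≤ Real.exp (-((p : ℝ) / 60)) * Real.exp (7 / 10 * m) := by
        gcongr
        exact two_pow_le_exp m
    _ ≤ _ := by
        rw [← Real.exp_add]
        exact Real.exp_le_exp.2 (by linarith)

lemma rows_failure_le {θ : ℝ} {k : ℕ} (hm : 1 ≤ m) (hθ : √p ≤ θ * p) (hk : (k : ℝ) ≤ 2 * (θ * p)) :
    Real.exp (-(3 / 8) * (6 * θ * m * p)) * 2 ^ (k * m) ≤ Real.exp (-(√p / 100)) := by
  have hm1 : (1 : ℝ) ≤ m := by exact_mod_cast hm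
  have h0 : 0 ≤ √(p : ℝ) := Real.sqrt_nonneg _
  calc Real.exp (-(3 / 8) * (6 * θ * m * p)) * 2 ^ (k * m)
      ≤ Real.exp (-(3 / 8) * (6 * θ * m * p)) * Real.exp (7 / 10 * (k * m)) := by
        gcongr
        exact_mod_cast two_pow_le_exp (k * m)
    _ ≤ _ := by
        rw [← Real.exp_add]
        refine Real.exp_le_exp.2 ?_
        have h1 : (k : ℝ) * m ≤ 2 * (θ * p) * m := by gcongr
        have h2 : √(p : ℝ) * 1 ≤ θ * p * m := mul_le_mul hθ hm1 zero_le_one (h0.trans hθ)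
        nlinarith

/-- Keeps only the fourth-order term of the exponential series at `√p / 100`. -/
lemma exp_neg_sqrt_le (hp : 0 < p) :
    Real.exp (-(√(p : ℝ) / 100)) ≤ 24 * 100 ^ 4 / (p : ℝ) ^ 2 := by
  have hs : 0 < √(p : ℝ) := Real.sqrt_pos.2 (by exact_mod_cast hp)
  have h := Real.pow_div_factorial_le_exp (√(p : ℝ) / 100) (by positivity) 4
  have h4 : √(p : ℝ) ^ 4 = (p : ℝ) ^ 2 := by
    rw [show 4 = 2 * 2 from rfl, pow_mul, Real.sq_sqrt (by positivity)]
  rw [div_pow, h4] at h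
  rw [Real.exp_neg]
  have hp' : (0 : ℝ) < p := by exact_mod_cast hp
  refine (inv_anti₀ (by positivity) h).trans_eq ?_
  norm_num [Nat.factorial]
  field_simp
  norm_num

end numerics

/-! ### The random support and its independence from `G`. -/

section sparse
variable {Ω : Type*} [MeasurableSpace Ω] {P : Measure Ω} {p m : ℕ}
  {θ : unitInterval} {x₀ : Ω → Fin p → ℝ} {G : Ω → Matrix (Fin p) (Fin m) ℝ}

/-- The support of a vector. -/
noncomputable def supp (x : Fin p → ℝ) : Finset (Fin p) := Finset.univ.filter fun i => x i ≠ 0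

namespace IsPlantedSparseModel

lemma isGaussianMatrix (hM : IsPlantedSparseModel P θ x₀ G) : IsGaussianMatrix P G :=
  ⟨fun k => hM.law_gauss k.1 k.2, hM.indep.precomp Sum.inr_injective⟩

lemma iIndepFun_sparse (hM : IsPlantedSparseModel P θ x₀ G) :
    iIndepFun (fun i ω => x₀ ω i) P := hM.indep.precomp Sum.inl_injective

lemma ae_eq_or_eq_zero (hM : IsPlantedSparseModel P θ x₀ G) :
    ∀ᵐ ω ∂P, ∀ i, x₀ ω i = 1 / √((θ : ℝ) * p) ∨ x₀ ω i = 0 := by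
  rw [ae_all_iff]
  intro i
  have hmeas : MeasurableSet {y : ℝ | y = 1 / √((θ : ℝ) * p) ∨ y = 0} :=
    (measurableSet_singleton _).union (measurableSet_singleton _)
  have h : ∀ᵐ y ∂(bernoulliMeasure (1 / √((θ : ℝ) * p)) 0 θ),
      y = 1 / √((θ : ℝ) * p) ∨ y = 0 := by
    rw [ae_iff]
    exact bernoulliMeasure_apply_of_notMem_of_notMem θ hmeas.compl (by simp) (by simp)
  rw [← (hM.law_sparse i).map_eq] at h
  exact ae_of_ae_map (hM.law_sparse i).aemeasurable h

lemma aemeasurable_entries (hM : IsPlantedSparseModel P θ x₀ G) (k : Fin p ⊕ Fin p × Fin m) :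
    AEMeasurable (fun ω => Sum.elim (fun i => x₀ ω i) (fun ij => G ω ij.1 ij.2) k) P := by
  rcases k with i | k
  exacts [(hM.law_sparse i).aemeasurable, (hM.law_gauss k.1 k.2).aemeasurable]

lemma indepFun_sparse_gauss (hM : IsPlantedSparseModel P θ x₀ G) :
    IndepFun x₀ (fun ω (k : Fin p × Fin m) => G ω k.1 k.2) P := by
  classical
  have h := hM.indep.indepFun_finset₀ (Finset.univ.map Function.Embedding.inl)
    (Finset.univ.map Function.Embedding.inr) (by
      rw [Finset.disjoint_left]
      simp) hM.aemeasurable_entries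
  exact h.comp
    (φ := fun f i => f ⟨Sum.inl i, by simp⟩) (ψ := fun f k => f ⟨Sum.inr k, by simp⟩)
    (measurable_pi_lambda _ fun _ => measurable_pi_apply _)
    (measurable_pi_lambda _ fun _ => measurable_pi_apply _)

/-- The support size is a sum of independent indicators; `1 + y ≤ exp y` bounds its moment
generating function by the Poisson one. -/
lemma integrable_and_mgf_card_supp [IsProbabilityMeasure P] (hM : IsPlantedSparseModel P θ x₀ G)
    (hθ : 0 < (θ : ℝ) * p) (t : ℝ) :
    Integrable (fun ω => Real.exp (t * (supp (x₀ ω)).card)) P ∧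
      mgf (fun ω => ((supp (x₀ ω)).card : ℝ)) P t ≤ Real.exp ((θ : ℝ) * p * (Real.exp t - 1)) := by
  let φ : ℝ → ℝ := fun y => if y ≠ 0 then 1 else 0
  have hφ : Measurable φ :=
    Measurable.ite (measurableSet_singleton (0 : ℝ)).compl measurable_const measurable_const
  have hind : iIndepFun (fun i ω => φ (x₀ ω i)) P := hM.iIndepFun_sparse.comp _ fun _ => hφ
  have hmeas (i) : AEMeasurable (fun ω => φ (x₀ ω i)) P :=
    hφ.comp_aemeasurable (hM.law_sparse i).aemeasurable
  have hcard (ω) : ((supp (x₀ ω)).card : ℝ) = ∑ i, φ (x₀ ω i) := by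
    simp only [supp, φ, Finset.card_filter]
    push_cast
    rfl
  have hv : 1 / √((θ : ℝ) * p) ≠ 0 := (one_div_pos.2 (Real.sqrt_pos.2 hθ)).ne'
  have hone (i) : mgf (fun ω => φ (x₀ ω i)) P t ≤ Real.exp ((θ : ℝ) * (Real.exp t - 1)) := by
    have h1 : mgf (fun ω => φ (x₀ ω i)) P t = 1 + (θ : ℝ) * (Real.exp t - 1) := by
      rw [mgf]
      have hm : Measurable fun y : ℝ => Real.exp (t * φ y) := by fun_prop
      refine ((hM.law_sparse i).integral_comp (f := fun y => Real.exp (t * φ y))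
        hm.aestronglyMeasurable).trans ?_
      rw [integral_bernoulliMeasure]
      simp only [φ, if_pos hv]
      simp
      ring
    rw [h1, add_comm]
    exact Real.add_one_le_exp _
  have hmgf : mgf (fun ω => ((supp (x₀ ω)).card : ℝ)) P t = ∏ i, mgf (fun ω => φ (x₀ ω i)) P t := by
    rw [← hind.mgf_sum₀ hmeas]
    congr 1
    ext ω
    rw [hcard, Finset.sum_apply]
  have hmeas2 : AEMeasurable (fun ω => ((supp (x₀ ω)).card : ℝ)) P := by
    simp only [hcard]
    exact Finset.aemeasurable_fun_sum _ fun i _ => hmeas i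
  constructor
  · refine Integrable.of_bound (hmeas2.const_mul t).exp.aestronglyMeasurable
      (Real.exp (|t| * p)) (Filter.Eventually.of_forall fun ω => ?_)
    rw [Real.norm_eq_abs, Real.abs_exp]
    refine Real.exp_le_exp.2 (mul_le_mul (le_abs_self t) ?_ (by positivity) (abs_nonneg _))
    exact_mod_cast (Finset.card_le_univ _).trans_eq (Fintype.card_fin p)
  · rw [hmgf]
    calc ∏ i, mgf (fun ω => φ (x₀ ω i)) P t
        ≤ ∏ _i : Fin p, Real.exp ((θ : ℝ) * (Real.exp t - 1)) :=
          Finset.prod_le_prod (fun _ _ => mgf_nonneg) fun i _ => hone i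
      _ = _ := by
          rw [Finset.prod_const, Finset.card_univ, Fintype.card_fin, ← Real.exp_nat_mul]
          congr 1
          ring

lemma measure_card_supp_ge [IsProbabilityMeasure P] (hM : IsPlantedSparseModel P θ x₀ G)
    (hp : 0 < p) (hθ : √p ≤ (θ : ℝ) * p) :
    P.real {ω | 2 * ((θ : ℝ) * p) ≤ (supp (x₀ ω)).card} ≤ Real.exp (-(√p / 100)) := by
  have hs : 0 < √(p : ℝ) := Real.sqrt_pos.2 (by exact_mod_cast hp)
  have h := hM.integrable_and_mgf_card_supp (hs.trans_le hθ) 1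
  refine (measure_ge_le_exp_mul_mgf _ zero_le_one h.1).trans ?_
  refine (mul_le_mul_of_nonneg_left h.2 (Real.exp_pos _).le).trans ?_
  rw [← Real.exp_add]
  exact Real.exp_le_exp.2 (by nlinarith [Real.exp_one_lt_d9])

lemma measure_card_supp_eq_zero [IsProbabilityMeasure P] (hM : IsPlantedSparseModel P θ x₀ G)
    (hp : 0 < p) (hθ : √p ≤ (θ : ℝ) * p) :
    P.real {ω | ((supp (x₀ ω)).card : ℝ) ≤ 0} ≤ Real.exp (-(√p / 100)) := by
  have hs : 0 < √(p : ℝ) := Real.sqrt_pos.2 (by exact_mod_cast hp)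
  have h := hM.integrable_and_mgf_card_supp (hs.trans_le hθ) (-1)
  refine (measure_le_le_exp_mul_mgf _ (by norm_num) h.1).trans ?_
  refine (mul_le_mul_of_nonneg_left h.2 (Real.exp_pos _).le).trans ?_
  rw [← Real.exp_add]
  have h1 : Real.exp (-1) ≤ 1 / 2 := by
    rw [Real.exp_neg, one_div]
    exact inv_anti₀ (by norm_num) (by linarith [Real.exp_one_gt_d9])
  exact Real.exp_le_exp.2 (by nlinarith)

/-- If, for each admissible support, an event about `G` has probability at most `b`, then so does
the event for the random support. -/
lemma measure_exists_supp_le [IsProbabilityMeasure P] (hM : IsPlantedSparseModel P θ x₀ G)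
    (S : Finset (Finset (Fin p))) (B : Finset (Fin p) → Set (Fin p × Fin m → ℝ))
    (hB : ∀ I, MeasurableSet (B I)) {b : ℝ} (hb0 : 0 ≤ b)
    (hb : ∀ I ∈ S, P.real {ω | (fun k => G ω k.1 k.2) ∈ B I} ≤ b) :
    P.real {ω | supp (x₀ ω) ∈ S ∧ (fun k => G ω k.1 k.2) ∈ B (supp (x₀ ω))} ≤ b := by
  have hind := hM.indepFun_sparse_gauss
  have hx : AEMeasurable x₀ P := aemeasurable_pi_iff.2 fun i => (hM.law_sparse i).aemeasurable
  have hsupp (I : Finset (Fin p)) : MeasurableSet {y : Fin p → ℝ | supp y = I} := by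
    have : {y : Fin p → ℝ | supp y = I} = ⋂ i, {y | y i ≠ 0 ↔ i ∈ I} := by
      ext y
      simp [supp, Finset.ext_iff]
    rw [this]
    refine MeasurableSet.iInter fun i => ?_
    have h0 : MeasurableSet {y : Fin p → ℝ | y i = 0} :=
      measurable_pi_apply (X := fun _ => ℝ) i (measurableSet_singleton (0 : ℝ))
    by_cases hi : i ∈ I
    · have h1 : {y : Fin p → ℝ | y i ≠ 0 ↔ i ∈ I} = {y | y i = 0}ᶜ := by
        ext y
        simp [hi]
      rw [h1]
      exact h0.compl
    · have h1 : {y : Fin p → ℝ | y i ≠ 0 ↔ i ∈ I} = {y | y i = 0} := by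
        ext y
        simp [hi]
      rw [h1]
      exact h0
  have hprod (I) : P.real ({ω | supp (x₀ ω) = I} ∩ {ω | (fun k => G ω k.1 k.2) ∈ B I}) =
      P.real {ω | supp (x₀ ω) = I} * P.real {ω | (fun k => G ω k.1 k.2) ∈ B I} := by
    simp only [measureReal_def, ← ENNReal.toReal_mul]
    congr 1
    exact hind.measure_inter_preimage_eq_mul _ _ (hsupp I) (hB I)
  -- Events with distinct supports are disjoint, so averaging over supports loses no union-bound
  -- factor.
  have hsum : ∑ I ∈ S, P.real {ω | supp (x₀ ω) = I} ≤ 1 := by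
    have h1 := measure_biUnion_finset₀ (μ := P) (s := S) (f := fun I => {ω | supp (x₀ ω) = I})
      (fun I _ J _ hIJ => (Set.disjoint_left.2 fun ω h1 h2 => hIJ (h1.symm.trans h2)).aedisjoint)
      (fun I _ => hx.nullMeasurableSet_preimage (hsupp I))
    simp only [measureReal_def]
    rw [← ENNReal.toReal_sum fun _ _ => measure_ne_top _ _, ← h1]
    exact measureReal_le_one
  calc _ ≤ P.real (⋃ I ∈ S, {ω | supp (x₀ ω) = I} ∩ {ω | (fun k => G ω k.1 k.2) ∈ B I}) := by
        refine measureReal_mono (fun ω hω => ?_) (measure_ne_top _ _)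
        simp only [Set.mem_iUnion]
        exact ⟨_, hω.1, rfl, hω.2⟩
    _ ≤ ∑ I ∈ S, P.real ({ω | supp (x₀ ω) = I} ∩ {ω | (fun k => G ω k.1 k.2) ∈ B I}) :=
        measureReal_biUnion_finset_le _ _
    _ ≤ ∑ I ∈ S, P.real {ω | supp (x₀ ω) = I} * b := by
        refine Finset.sum_le_sum fun I hI => ?_
        rw [hprod]
        exact mul_le_mul_of_nonneg_left (hb I hI) measureReal_nonneg
    _ ≤ b := by
        rw [← Finset.sum_mul]
        exact mul_le_of_le_one_left hb0 hsum

end IsPlantedSparseModel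

end sparse

/-! ### Assembly of the good events. -/

section main
variable {p m : ℕ}

/-- The vector with value `v` on `I` and `0` elsewhere. -/
noncomputable def flatVec (v : ℝ) (I : Finset (Fin p)) : Fin p → ℝ := fun i => if i ∈ I then v else 0

lemma flatVec_ne_zero {v : ℝ} (hv : v ≠ 0) {I : Finset (Fin p)} (hI : I.Nonempty) :
    flatVec v I ≠ 0 := by
  obtain ⟨i, hi⟩ := hI
  intro h
  have := congrFun h i
  rw [flatVec, if_pos hi] at this
  exact hv this

lemma eq_flatVec_supp {v : ℝ} {x : Fin p → ℝ} (h : ∀ i, x i = v ∨ x i = 0) :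
    x = flatVec v (supp x) := by
  ext i
  rw [flatVec]
  split_ifs with hi
  · exact (h i).resolve_right (by simpa [supp] using hi)
  · simpa [supp] using hi

lemma dotProduct_sq_le {k : ℕ} (a b : Fin k → ℝ) : (a ⬝ᵥ b) ^ 2 ≤ (a ⬝ᵥ a) * (b ⬝ᵥ b) := by
  simp only [dotProduct, ← sq]
  exact Finset.sum_mul_sq_le_sq_mul_sq _ _ _

/-- The good events for `G` imply the conclusion for a flat vector. -/
lemma conclusion_of_bounds {v θ : ℝ} (hv : v ≠ 0) {I : Finset (Fin p)} (hI : I.Nonempty)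
    {G : Matrix (Fin p) (Fin m) ℝ} {x : Fin p → ℝ} (hx : x = flatVec v I)
    (hG : ∀ a, 1 / 9 * (a ⬝ᵥ a) ≤ (G *ᵥ a) ⬝ᵥ (G *ᵥ a))
    (hxG : (x ᵥ* G) ⬝ᵥ (x ᵥ* G) ≤ 2 / 45 * (x ⬝ᵥ x))
    (hrows : ∑ i ∈ I, ∑ j, G i j ^ 2 ≤ 6 * θ * m) (hθ : 1 ≤ θ * (m + 1)) :
    IsOrthonormalBasisOf (canonicalBasis x G) (plantedSubspace x G) ∧
      ∃ i : Fin p, 1 / (10 * √(θ * (m + 1))) ≤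
          |initVec (canonicalBasis x G) i ⬝ᵥ Pi.single 0 1| ∧
        ∀ (Y : Matrix (Fin p) (Fin (m + 1)) ℝ) (q : Fin (m + 1) → ℝ),
          IsOrthonormalBasisOf Y (plantedSubspace x G) → IsTarget Y x q →
            1 / (10 * √(θ * (m + 1))) ≤ |initVec Y i ⬝ᵥ q| := by
  have hx0 : x ≠ 0 := hx ▸ flatVec_ne_zero hv hI
  have hxx := dotProduct_self_pos hx0
  -- Cauchy–Schwarz bounds the loss along `x` by `2/45`, and `1/9 - 2/45 = 1/15`.
  have hquad (a : Fin m → ℝ) : 1 / 15 * (a ⬝ᵥ a) ≤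
      (G *ᵥ a) ⬝ᵥ (G *ᵥ a) - (x ⬝ᵥ x)⁻¹ * (x ⬝ᵥ (G *ᵥ a)) ^ 2 := by
    have h1 : (x ⬝ᵥ (G *ᵥ a)) ^ 2 ≤ 2 / 45 * (x ⬝ᵥ x) * (a ⬝ᵥ a) := by
      rw [Matrix.dotProduct_mulVec]
      exact (dotProduct_sq_le _ _).trans
        (mul_le_mul_of_nonneg_right hxG (by rw [← l2norm_sq]; positivity))
    have h2 : (x ⬝ᵥ x)⁻¹ * (x ⬝ᵥ (G *ᵥ a)) ^ 2 ≤ 2 / 45 * (a ⬝ᵥ a) := by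
      rw [inv_mul_le_iff₀ hxx]
      linarith
    linarith [hG a]
  obtain ⟨hB, i, hi⟩ := orthonormal_and_correlation hv hI
    (fun i => by rw [hx, flatVec]) (by norm_num) hquad hrows
  have hθ0 : 0 < θ := pos_of_mul_pos_left (by linarith) (by positivity : (0 : ℝ) ≤ m + 1)
  -- `1 + 90 θ m ≤ 100 θ (m + 1)` because `θ (m + 1) ≥ 1`.
  have hbound : 1 / (10 * √(θ * (m + 1))) ≤ (√(1 + 6 * θ * m / (1 / 15)))⁻¹ := by
    have h10 : 10 * √(θ * (m + 1)) = √(100 * (θ * (m + 1))) := by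
      rw [Real.sqrt_mul (x := 100) (by norm_num),
        show (100 : ℝ) = 10 ^ 2 by norm_num, Real.sqrt_sq (x := 10) (by norm_num)]
    rw [h10, one_div]
    have h0 : 0 ≤ θ * m := by positivity
    refine inv_anti₀ (Real.sqrt_pos.2 ?_) (Real.sqrt_le_sqrt ?_)
    · have : 6 * θ * m / (1 / 15) = 90 * (θ * m) := by ring
      linarith
    · have : 6 * θ * m / (1 / 15) = 90 * (θ * m) := by ring
      linarith [mul_add θ m 1]
  exact ⟨hB, i, hbound.trans (hi _ _ hB (isTarget_canonicalBasis hx0 G)),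
    fun Y q hY hq => hbound.trans (hi Y q hY hq)⟩

/-- The bad event for `G` given the support `I` of the planted vector. -/
def badSet (v u : ℝ) (I : Finset (Fin p)) : Set (Fin p × Fin m → ℝ) :=
  {z | 2 / 45 * (flatVec v I ⬝ᵥ flatVec v I) ≤
      ∑ j, (∑ i, flatVec v I i * z (i, j)) * (∑ i, flatVec v I i * z (i, j))} ∪
    {z | u ≤ ∑ i ∈ I, ∑ j, z (i, j) ^ 2}

lemma measurableSet_badSet (v u : ℝ) (I : Finset (Fin p)) :
    MeasurableSet (badSet (m := m) v u I) :=
  (measurableSet_le measurable_const (by fun_prop)).union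
    (measurableSet_le measurable_const (by fun_prop))

theorem planted_sparse_good_initialization {Ω : Type*} [MeasurableSpace Ω] {P : Measure Ω}
    [IsProbabilityMeasure P] {θ : unitInterval} {x₀ : Ω → Fin p → ℝ}
    {G : Ω → Matrix (Fin p) (Fin m) ℝ} (hM : IsPlantedSparseModel P θ x₀ G)
    (hθn : 1 / √((m : ℝ) + 1) < (θ : ℝ)) (hpm : 1000 * ((m : ℝ) + 1) ≤ p) :
    1 - 2 * 10 ^ 10 / (p : ℝ) ^ 2 ≤ P.real {ω |
      IsOrthonormalBasisOf (canonicalBasis (x₀ ω) (G ω)) (plantedSubspace (x₀ ω) (G ω)) ∧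
      ∃ i : Fin p, 1 / (10 * √((θ : ℝ) * (m + 1))) ≤
          |initVec (canonicalBasis (x₀ ω) (G ω)) i ⬝ᵥ Pi.single 0 1| ∧
        ∀ (Y : Matrix (Fin p) (Fin (m + 1)) ℝ) (q : Fin (m + 1) → ℝ),
          IsOrthonormalBasisOf Y (plantedSubspace (x₀ ω) (G ω)) → IsTarget Y (x₀ ω) q →
            1 / (10 * √((θ : ℝ) * (m + 1))) ≤ |initVec Y i ⬝ᵥ q|} := by
  set good := {ω | IsOrthonormalBasisOf (canonicalBasis (x₀ ω) (G ω))
      (plantedSubspace (x₀ ω) (G ω)) ∧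
      ∃ i : Fin p, 1 / (10 * √((θ : ℝ) * (m + 1))) ≤
          |initVec (canonicalBasis (x₀ ω) (G ω)) i ⬝ᵥ Pi.single 0 1| ∧
        ∀ (Y : Matrix (Fin p) (Fin (m + 1)) ℝ) (q : Fin (m + 1) → ℝ),
          IsOrthonormalBasisOf Y (plantedSubspace (x₀ ω) (G ω)) → IsTarget Y (x₀ ω) q →
            1 / (10 * √((θ : ℝ) * (m + 1))) ≤ |initVec Y i ⬝ᵥ q|}
  have hm0 : (0 : ℝ) ≤ m := m.cast_nonneg
  have hpR : (0 : ℝ) < p := by linarith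
  have hp : 0 < p := by exact_mod_cast hpR
  have hn : 0 < √((m : ℝ) + 1) := Real.sqrt_pos.2 (by linarith)
  have hθ1 : (θ : ℝ) ≤ 1 := θ.2.2
  have hθ0 : 0 < (θ : ℝ) := (one_div_pos.2 hn).trans hθn
  have hθn' : 1 < (θ : ℝ) * √((m : ℝ) + 1) := by rwa [div_lt_iff₀ hn] at hθn
  have hsq : √((m : ℝ) + 1) * √((m : ℝ) + 1) = m + 1 := Real.mul_self_sqrt (by linarith)
  -- `m = 0` would force `θ > 1`; the row-sum tail bound is useless in that case.
  have hm : 1 ≤ m := by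
    rcases Nat.eq_zero_or_pos m with rfl | h
    · simp at hθn'
      linarith
    · exact h
  have hθm : 1 ≤ (θ : ℝ) * (m + 1) := by
    have h1 : (1 : ℝ) ≤ √((m : ℝ) + 1) := Real.one_le_sqrt.2 (by linarith)
    rw [← hsq]
    nlinarith
  -- From `θ √n > 1` and `n ≤ p`; this is where the scale `√p` in the failure probabilities comes
  -- from.
  have hθp : √(p : ℝ) ≤ (θ : ℝ) * p := by
    have h1 : √((m : ℝ) + 1) ≤ √(p : ℝ) := Real.sqrt_le_sqrt (by linarith)
    have h2 : √(p : ℝ) * √(p : ℝ) = p := Real.mul_self_sqrt hpR.le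
    have h3 : 1 ≤ (θ : ℝ) * √(p : ℝ) := by nlinarith
    nlinarith [Real.sqrt_nonneg (p : ℝ)]
  set v : ℝ := 1 / √((θ : ℝ) * p) with hvdef
  have hv : v ≠ 0 := (one_div_pos.2 (Real.sqrt_pos.2 (mul_pos hθ0 hpR))).ne'
  set e := Real.exp (-(√(p : ℝ) / 100)) with he
  have hGm := hM.isGaussianMatrix
  classical
  let S : Finset (Finset (Fin p)) :=
    Finset.univ.filter fun I => I.Nonempty ∧ (I.card : ℝ) ≤ 2 * ((θ : ℝ) * p)
  have hE1 : P.real {ω | ¬ ∀ a, 1 / 9 * (a ⬝ᵥ a) ≤ (G ω *ᵥ a) ⬝ᵥ (G ω *ᵥ a)} ≤ 2 * e :=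
    (hGm.measure_not_lower_bound_le hp.ne').trans (net_failure_le hpm)
  have hE2 : P.real {ω | supp (x₀ ω) ∈ S ∧
      (fun k : Fin p × Fin m => G ω k.1 k.2) ∈ badSet v (6 * θ * m) (supp (x₀ ω))} ≤ 2 * e := by
    refine hM.measure_exists_supp_le S _ (measurableSet_badSet v _) (by positivity) fun I hI => ?_
    obtain ⟨hne, hcard⟩ := (Finset.mem_filter.1 hI).2
    refine (measureReal_union_le _ _).trans ?_
    rw [two_mul]
    exact add_le_add
      ((hGm.measure_vecMul_ge hp.ne' (flatVec_ne_zero hv hne)).trans (vecMul_failure_le hpm))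
      ((hGm.measure_sum_rows_ge hp.ne' I _).trans (rows_failure_le hm hθp hcard))
  have hE3 := hM.measure_card_supp_ge hp hθp
  have hE4 := hM.measure_card_supp_eq_zero hp hθp
  have hE5 : P.real {ω | ¬ ∀ i, x₀ ω i = v ∨ x₀ ω i = 0} = 0 := by
    rw [measureReal_def, ae_iff.1 hM.ae_eq_or_eq_zero, ENNReal.toReal_zero]
  set E1 := {ω | ¬ ∀ a, 1 / 9 * (a ⬝ᵥ a) ≤ (G ω *ᵥ a) ⬝ᵥ (G ω *ᵥ a)}
  set E2 := {ω | supp (x₀ ω) ∈ S ∧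
    (fun k : Fin p × Fin m => G ω k.1 k.2) ∈ badSet v (6 * θ * m) (supp (x₀ ω))}
  set E3 := {ω | 2 * ((θ : ℝ) * p) ≤ (supp (x₀ ω)).card}
  set E4 := {ω | ((supp (x₀ ω)).card : ℝ) ≤ 0}
  set E5 := {ω | ¬ ∀ i, x₀ ω i = v ∨ x₀ ω i = 0}
  -- Covering the whole space and using subadditivity avoids any measurability of the good event.
  have hcover : (Set.univ : Set Ω) ⊆ good ∪ (E1 ∪ (E2 ∪ (E3 ∪ (E4 ∪ E5)))) := by
    intro ω _
    by_contra hcon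
    simp only [Set.mem_union, not_or] at hcon
    obtain ⟨h0, h1, h2, h3, h4, h5⟩ := hcon
    have h1' := not_not.1 h1
    have h3' : ((supp (x₀ ω)).card : ℝ) < 2 * ((θ : ℝ) * p) := not_le.1 h3
    have h4' : (0 : ℝ) < (supp (x₀ ω)).card := not_le.1 h4
    have hx := eq_flatVec_supp (not_not.1 h5)
    have hne : (supp (x₀ ω)).Nonempty := Finset.card_pos.1 (by exact_mod_cast h4')
    have hS : supp (x₀ ω) ∈ S := Finset.mem_filter.2 ⟨Finset.mem_univ _, hne, h3'.le⟩
    have hbad : (fun k : Fin p × Fin m => G ω k.1 k.2) ∉ badSet v (6 * θ * m) (supp (x₀ ω)) :=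
      fun h => h2 ⟨hS, h⟩
    rw [badSet, ← hx] at hbad
    obtain ⟨hb1, hb2⟩ := not_or.1 hbad
    exact h0 (conclusion_of_bounds hv hne hx h1' (not_le.1 hb1).le (not_le.1 hb2).le hθm)
  have htot : (1 : ℝ) ≤ P.real good + (2 * e + (2 * e + (e + (e + 0)))) := by
    calc (1 : ℝ) = P.real Set.univ := by simp
      _ ≤ P.real (good ∪ (E1 ∪ (E2 ∪ (E3 ∪ (E4 ∪ E5))))) := measureReal_mono hcover
      _ ≤ P.real good + (P.real E1 + (P.real E2 + (P.real E3 + (P.real E4 + P.real E5)))) := by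
          refine (measureReal_union_le _ _).trans (add_le_add_right ?_ _)
          refine (measureReal_union_le _ _).trans (add_le_add_right ?_ _)
          refine (measureReal_union_le _ _).trans (add_le_add_right ?_ _)
          refine (measureReal_union_le _ _).trans (add_le_add_right ?_ _)
          exact measureReal_union_le _ _
      _ ≤ _ := by
          rw [hE5]
          gcongr
  have hexp := exp_neg_sqrt_le hp
  -- Six failure terms: `6 * 24 * 100 ^ 4 = 1.44 * 10 ^ 10`.
  have h6 : 6 * e ≤ 2 * 10 ^ 10 / (p : ℝ) ^ 2 := by
    calc 6 * e ≤ 6 * (24 * 100 ^ 4 / (p : ℝ) ^ 2) := by gcongr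
      _ = (6 * (24 * 100 ^ 4)) / (p : ℝ) ^ 2 := by ring
      _ ≤ _ := by
          refine div_le_div_of_nonneg_right ?_ (by positivity)
          norm_num
  linarith

end main

end PlantedSparse

/-- Good initialization in the planted sparse model, with `n = m + 1`. -/
theorem proposition1 :
    ∃ C c : ℝ, 0 < C ∧ 0 < c ∧
      ∀ (n m p : ℕ) (θ : unitInterval), n = m + 1 → 1 / √(n : ℝ) < (θ : ℝ) → C * n ≤ (p : ℝ) →
      ∀ (Ω : Type*) [MeasurableSpace Ω] (P : Measure Ω) [IsProbabilityMeasure P]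
        (x₀ : Ω → Fin p → ℝ) (G : Ω → Matrix (Fin p) (Fin m) ℝ),
        PlantedSparse.IsPlantedSparseModel P θ x₀ G →
        1 - c / (p : ℝ) ^ 2 ≤ P.real {ω |
          PlantedSparse.IsOrthonormalBasisOf (PlantedSparse.canonicalBasis (x₀ ω) (G ω))
            (PlantedSparse.plantedSubspace (x₀ ω) (G ω)) ∧
          ∃ i : Fin p,
            1 / (10 * √((θ : ℝ) * n)) ≤
              |PlantedSparse.initVec (PlantedSparse.canonicalBasis (x₀ ω) (G ω)) i ⬝ᵥ
                Pi.single 0 1| ∧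
            ∀ (Y : Matrix (Fin p) (Fin (m + 1)) ℝ) (q : Fin (m + 1) → ℝ),
              PlantedSparse.IsOrthonormalBasisOf Y
                (PlantedSparse.plantedSubspace (x₀ ω) (G ω)) →
              PlantedSparse.IsTarget Y (x₀ ω) q →
              1 / (10 * √((θ : ℝ) * n)) ≤ |PlantedSparse.initVec Y i ⬝ᵥ q|} := by
  refine ⟨1000, 2 * 10 ^ 10, by norm_num, by norm_num, ?_⟩
  rintro n m p θ rfl hθ hp Ω _ P _ x₀ G hM
  rw [Nat.cast_add_one] at hθ hp ⊢
  exact PlantedSparse.planted_sparse_good_initialization hM hθ hp
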